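/- Let $B=(B_t)_{t\ge 0}$ be a standard real Brownian motion started at $0$, and let $T_1=\inf\{t\ge 0 : B_t=1\}$ be its first hitting time of the level $1$ (which satisfies $0<T_1<\infty$ almost surely). Then the random variable $$A_1^{(1)}=\frac{1}{T_1^{3/2}}\int_0^{T_1}B_s\,ds$$ has moments of all orders, i.e. $\mathbb E\big[|A_1^{(1)}|^p\big]<\infty$ for every real $p>0$, and it is centered, i.e. $\mathbb E\big[A_1^{(1)}\big]=0$. -/

import Mathlib

open MeasureTheory ProbabilityTheory
open scoped NNReal ENNReal

/-- The first hitting time `T_a = inf {t ≥ 0 : X t = a}` of the level `a` by the process `X`,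
equal to `⊤` on the event that the level is never hit. -/
noncomputable def levelHittingTime {Ω : Type*} (X : ℝ≥0 → Ω → ℝ) (a : ℝ) (ω : Ω) :
    WithTop ℝ≥0 :=
  hittingAfter X {a} 0 ω

/-- The first hitting time of the level `a`, as a real number
(with the value `0` on the event that the level is never hit). -/
noncomputable def levelHittingTimeReal {Ω : Type*} (X : ℝ≥0 → Ω → ℝ) (a : ℝ) (ω : Ω) : ℝ :=
  ((levelHittingTime X a ω).untopD 0 : ℝ≥0)

/-- The random variable `T_1 ^ (-3/2) * ∫_0^{T_1} X_s ds`, where `T_1` is the first hitting time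
of the level `1` by `X`. -/
noncomputable def normalizedPathIntegral {Ω : Type*} (X : ℝ≥0 → Ω → ℝ) (ω : Ω) : ℝ :=
  levelHittingTimeReal X 1 ω ^ (-(3 / 2) : ℝ) *
    ∫ s in (0 : ℝ)..levelHittingTimeReal X 1 ω, X s.toNNReal ω

/-! Write `T` for the hitting time of `1` and `I` for the integral of the path up to `T`. For `c >
0` the processes `M_t = exp (c B_t - c² t / 2)` and `M_t (∫_0^t B_s ds - B_t² / (2c) + B_t / (2c²))`
are martingales. Stopping both at `T`, where `B = 1`, gives `E[exp (-c² T / 2)] = exp (-c)` and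
`E[exp (-c² T / 2) I] = exp (-c) (c - 1) / (2c²)` (`integral_exp_neg_levelHittingTimeReal`,
`integral_exp_mul_pathIntegral`).

Centering: `∫_0^∞ c² exp (-c² T / 2) dc = κ T^(-3/2)`, so integrating the second identity against
`c² dc` gives `κ E[T^(-3/2) I] = (1/2) ∫_0^∞ exp (-c) (c - 1) dc = (Γ(2) - Γ(1)) / 2 = 0`. Fubini
needs the integrability of `T^(-3/2) I`, which comes from the moment bounds.

Moments: Jensen's inequality and a weighted Young inequality bound `(T^(-3/2) I)^(2n)` by
`T^(-(2n+1)) (1 + T)^(2n+5/4)` plus the integral of `(1 + s)^(-(2n+5/4)) B_s^(4n)` over all `s > 0`.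
The second term no longer involves `T` and has finite mean by Brownian scaling. The first reduces to
negative moments of `T` and to `E[T^(1/4)]`, both read off the Laplace transform of `T` by
integrating it against powers of `c`.

Optional stopping is proved by hand: the two martingales are replaced by exact discrete martingales
on a grid of mesh `δ`, stopped at the first grid point not before `min T K`. Bounds in `L²` uniform
in `δ` allow `δ → 0`, and dominated convergence allows `K → ∞`. -/

open Filter Topology

/-! ### Convergence of means, finite moments, exponential moments of Gaussians. -/

section General

variable {Ω : Type*} [MeasurableSpace Ω] {P : Measure Ω}

/-- A sequence bounded in `L²` which converges almost everywhere converges in mean. -/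
lemma tendsto_integral_of_integral_sq_le [IsFiniteMeasure P] {X : ℕ → Ω → ℝ} {Y : Ω → ℝ} {C : ℝ}
    (hX : ∀ n, AEStronglyMeasurable (X n) P) (hint : ∀ n, Integrable (fun ω ↦ X n ω ^ 2) P)
    (hC : ∀ n, ∫ ω, X n ω ^ 2 ∂P ≤ C) (hlim : ∀ᵐ ω ∂P, Tendsto (X · ω) atTop (𝓝 (Y ω))) :
    Tendsto (fun n ↦ ∫ ω, X n ω ∂P) atTop (𝓝 (∫ ω, Y ω ∂P)) := by
  have hmem n : MemLp (X n) 2 P := (memLp_two_iff_integrable_sq (hX n)).2 (hint n)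
  have hXi n : Integrable (X n) P := (hmem n).integrable (by norm_num)
  have hYm : AEStronglyMeasurable Y P := aestronglyMeasurable_of_tendsto_ae atTop hX hlim
  have hC0 : 0 ≤ C := (integral_nonneg fun ω ↦ sq_nonneg (X 0 ω)).trans (hC 0)
  have hL n (c : ℝ) (hc : 0 ≤ c) :
      ∫⁻ ω, ENNReal.ofReal (c * X n ω ^ 2) ∂P ≤ ENNReal.ofReal (c * C) := by
    rw [← ofReal_integral_eq_lintegral_ofReal ((hint n).const_mul c)
      (ae_of_all _ fun ω ↦ by positivity), integral_const_mul]
    exact ENNReal.ofReal_le_ofReal (mul_le_mul_of_nonneg_left (hC n) hc)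
  -- From `|x| ≤ 1 + x²`; with Fatou this puts the limit `Y` in `L¹`.
  have hbound n : eLpNorm (X n) 1 P ≤ P Set.univ + ENNReal.ofReal (1 * C) := by
    rw [eLpNorm_one_eq_lintegral_enorm]
    calc ∫⁻ ω, ‖X n ω‖ₑ ∂P ≤ ∫⁻ ω, 1 + ENNReal.ofReal (1 * X n ω ^ 2) ∂P := by
          refine lintegral_mono fun ω ↦ ?_
          rw [← ENNReal.ofReal_one, ← ENNReal.ofReal_add zero_le_one (by positivity),
            ← ofReal_norm, Real.norm_eq_abs]
          refine ENNReal.ofReal_le_ofReal ?_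
          nlinarith [sq_abs (X n ω), sq_nonneg (|X n ω| - 1), abs_nonneg (X n ω)]
      _ ≤ _ := by
          rw [lintegral_add_left measurable_const, lintegral_one]
          gcongr
          exact hL n 1 zero_le_one
  have hYi : MemLp Y 1 P := by
    refine ⟨hYm, (Lp.eLpNorm_lim_le_liminf_eLpNorm hX Y hlim).trans_lt ?_⟩
    refine lt_of_le_of_lt ?_ (ENNReal.add_lt_top.2 ⟨measure_lt_top P Set.univ,
      ENNReal.ofReal_lt_top (r := 1 * C)⟩)
    exact (liminf_le_liminf (Eventually.of_forall hbound)).trans (by simp)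
  refine tendsto_integral_of_L1' Y hYm (Eventually.of_forall hXi)
    (tendsto_Lp_finite_of_tendsto_ae le_rfl ENNReal.one_ne_top hX hYi ?_ hlim)
  -- Where `|X n| ≥ k` one has `|X n| ≤ X n² / k`, with integral at most `C / k`. The level `k = C /
  -- ε + 1` makes this at most `ε` and stays positive when `C = 0`.
  refine unifIntegrable_of le_rfl ENNReal.one_ne_top hX fun ε hε ↦
    ⟨(C / ε + 1).toNNReal, fun n ↦ ?_⟩
  rw [eLpNorm_one_eq_lintegral_enorm]
  have hK : 0 < C / ε + 1 := by positivity
  calc _ ≤ ∫⁻ ω, ENNReal.ofReal ((C / ε + 1)⁻¹ * X n ω ^ 2) ∂P := by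
        refine lintegral_mono fun ω ↦ ?_
        by_cases h : ω ∈ {x | (C / ε + 1).toNNReal ≤ ‖X n x‖₊}
        · rw [Set.indicator_of_mem h, ← ofReal_norm]
          refine ENNReal.ofReal_le_ofReal ?_
          have h' : C / ε + 1 ≤ |X n ω| := Real.toNNReal_le_iff_le_coe.1 h
          rw [inv_mul_eq_div, le_div_iff₀ hK, ← sq_abs, Real.norm_eq_abs, sq]
          gcongr
        · rw [Set.indicator_of_notMem h]; simp
    _ ≤ ENNReal.ofReal ((C / ε + 1)⁻¹ * C) := hL n _ (by positivity)
    _ ≤ ENNReal.ofReal ε := by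
        refine ENNReal.ofReal_le_ofReal ?_
        rw [inv_mul_eq_div, div_le_iff₀ hK]
        field_simp
        linarith

/-- A random variable all of whose moments are finite. -/
def HasFiniteMoments (X : Ω → ℝ) (P : Measure Ω) : Prop := ∀ p : ℝ≥0∞, p ≠ ∞ → MemLp X p P

namespace HasFiniteMoments

variable {X Y : Ω → ℝ}

lemma integrable (hX : HasFiniteMoments X P) : Integrable X P :=
  memLp_one_iff_integrable.1 (hX 1 ENNReal.one_ne_top)

lemma mul (hX : HasFiniteMoments X P) (hY : HasFiniteMoments Y P) :
    HasFiniteMoments (fun ω ↦ X ω * Y ω) P := fun p hp ↦ by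
  have : ENNReal.HolderTriple (2 * p) (2 * p) p := ⟨by
    rw [ENNReal.mul_inv (by simp) (by simp), ← add_mul, ENNReal.inv_two_add_inv_two, one_mul]⟩
  exact (hY (2 * p) (by finiteness)).mul (hX (2 * p) (by finiteness))

lemma add (hX : HasFiniteMoments X P) (hY : HasFiniteMoments Y P) :
    HasFiniteMoments (fun ω ↦ X ω + Y ω) P := fun p hp ↦ (hX p hp).add (hY p hp)

lemma sum {ι : Type*} {s : Finset ι} {X : ι → Ω → ℝ} (hX : ∀ i ∈ s, HasFiniteMoments (X i) P) :
    HasFiniteMoments (fun ω ↦ ∑ i ∈ s, X i ω) P := fun p hp ↦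
  memLp_finsetSum s fun i hi ↦ hX i hi p hp

lemma const [IsFiniteMeasure P] (c : ℝ) : HasFiniteMoments (fun _ : Ω ↦ c) P :=
  fun _ _ ↦ memLp_const c

lemma const_mul (hX : HasFiniteMoments X P) (c : ℝ) : HasFiniteMoments (fun ω ↦ c * X ω) P :=
  fun p hp ↦ (hX p hp).const_mul c

lemma abs (hX : HasFiniteMoments X P) : HasFiniteMoments (fun ω ↦ |X ω|) P :=
  fun p hp ↦ (hX p hp).abs

lemma pow [IsFiniteMeasure P] (hX : HasFiniteMoments X P) (n : ℕ) :
    HasFiniteMoments (fun ω ↦ X ω ^ n) P := by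
  induction n with
  | zero => simpa using const 1
  | succ n ih => simpa only [pow_succ] using ih.mul hX

lemma indicator (hX : HasFiniteMoments X P) {s : Set Ω} (hs : MeasurableSet s) :
    HasFiniteMoments (s.indicator X) P := fun p hp ↦ (hX p hp).indicator hs

lemma of_gaussian {v : ℝ≥0} (hX : HasLaw X (gaussianReal 0 v) P) : HasFiniteMoments X P :=
  fun p hp ↦ by
    have := memLp_id_gaussianReal' (μ := 0) (v := v) p hp
    rw [← hX.map_eq, memLp_map_measure_iff (by fun_prop) hX.aemeasurable] at this
    exact this

lemma exp_of_gaussian {v : ℝ≥0} (hX : HasLaw X (gaussianReal 0 v) P) (c : ℝ) :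
    HasFiniteMoments (fun ω ↦ Real.exp (c * X ω)) P := fun p hp ↦ by
  have hm : AEStronglyMeasurable (fun ω ↦ Real.exp (c * X ω)) P :=
    (hX.aemeasurable.const_mul c).exp.aestronglyMeasurable
  rcases eq_or_ne p 0 with rfl | h0
  · exact memLp_zero_iff_aestronglyMeasurable.2 hm
  · rw [← integrable_norm_rpow_iff hm h0 hp]
    have := integrable_exp_mul_gaussianReal (μ := 0) (v := v) (c * p.toReal)
    rw [← hX.map_eq, integrable_map_measure (by fun_prop) hX.aemeasurable] at this
    refine this.congr (ae_of_all _ fun ω ↦ ?_)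
    simp only [Function.comp, Real.norm_eq_abs, Real.abs_exp, ← Real.exp_mul]
    ring_nf

end HasFiniteMoments

section GaussianMoments

variable {X : Ω → ℝ} {v : ℝ≥0}

lemma integral_exp_mul_gaussian (hX : HasLaw X (gaussianReal 0 v) P) (c : ℝ) :
    ∫ ω, Real.exp (c * X ω) ∂P = Real.exp (v * c ^ 2 / 2) := by
  have := mgf_gaussianReal hX.map_eq c
  simpa [mgf] using this

/-- The derivative in `c` of the moment generating function, computed in two ways; one more
derivative gives the quadratic version below. -/
lemma integral_id_mul_exp_gaussian (hX : HasLaw X (gaussianReal 0 v) P) (c : ℝ) :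
    ∫ ω, X ω * Real.exp (c * X ω) ∂P = v * c * Real.exp (v * c ^ 2 / 2) := by
  have hset : integrableExpSet X P = Set.univ := Set.eq_univ_of_forall fun c ↦
    (HasFiniteMoments.exp_of_gaussian hX c).integrable
  have h := hasDerivAt_mgf (X := X) (μ := P) (t := c) (by simp [hset])
  have hmgf : mgf X P = fun t ↦ Real.exp (v * t ^ 2 / 2) :=
    funext fun t ↦ integral_exp_mul_gaussian hX t
  rw [hmgf] at h
  refine h.unique ?_
  have := ((((hasDerivAt_id c).pow 2).const_mul (v : ℝ)).div_const 2).exp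
  simp only [id] at this
  refine this.congr_deriv ?_
  simp; ring

lemma integral_sq_mul_exp_gaussian (hX : HasLaw X (gaussianReal 0 v) P) (c : ℝ) :
    ∫ ω, X ω ^ 2 * Real.exp (c * X ω) ∂P = (v + (v * c) ^ 2) * Real.exp (v * c ^ 2 / 2) := by
  have hset : integrableExpSet X P = Set.univ := Set.eq_univ_of_forall fun c ↦
    (HasFiniteMoments.exp_of_gaussian hX c).integrable
  have h := hasDerivAt_integral_pow_mul_exp_real (X := X) (μ := P) (t := c) (by simp [hset]) 1
  have hmgf : (fun t ↦ ∫ ω, X ω ^ 1 * Real.exp (t * X ω) ∂P) =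
      fun t ↦ v * t * Real.exp (v * t ^ 2 / 2) :=
    funext fun t ↦ by simpa using integral_id_mul_exp_gaussian hX t
  rw [hmgf] at h
  refine h.unique ?_
  have := ((hasDerivAt_id c).const_mul (v : ℝ)).mul
    ((((hasDerivAt_id c).pow 2).const_mul (v : ℝ)).div_const 2).exp
  simp only [id] at this
  refine this.congr_deriv ?_
  simp; ring

end GaussianMoments

end General

/-- Riemann sums with mesh `1 / (n + 1)` and a converging right endpoint. -/
lemma tendsto_riemann_sum {f : ℝ → ℝ} (hf : Continuous f) {r : ℕ → ℕ} {t : ℝ}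
    (hr : Tendsto (fun n ↦ (r n : ℝ) / (n + 1)) atTop (𝓝 t)) :
    Tendsto (fun n : ℕ ↦ (1 / ((n : ℝ) + 1)) * ∑ j ∈ Finset.range (r n), f (j / (n + 1)))
      atTop (𝓝 (∫ s in (0 : ℝ)..t, f s)) := by
  have hprim : Tendsto (fun n : ℕ ↦ ∫ s in (0 : ℝ)..(r n : ℝ) / (n + 1), f s) atTop
      (𝓝 (∫ s in (0 : ℝ)..t, f s)) :=
    ((intervalIntegral.continuous_primitive (fun a b ↦ hf.intervalIntegrable a b) 0).tendsto t).comp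
      hr
  refine (tendsto_iff_of_dist ?_).1 hprim
  obtain ⟨R, hR⟩ := hr.bddAbove_range
  have hR' n : (r n : ℝ) / (n + 1) ≤ R := hR ⟨n, rfl⟩
  have hR0 : 0 ≤ R := le_trans (by positivity) (hR' 0)
  have huc := (isCompact_Icc (a := (0 : ℝ)) (b := R)).uniformContinuousOn_of_continuous
    hf.continuousOn
  rw [Metric.uniformContinuousOn_iff] at huc
  rw [Metric.tendsto_atTop]
  intro ε hε
  -- There are `r n` cells of length `1 / (n + 1)`, of total length at most `R`, so an oscillation
  -- of `ε / (R + 1)` per cell gives an error strictly below `ε`.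
  obtain ⟨η, hη, hu⟩ := huc (ε / (R + 1)) (by positivity)
  obtain ⟨N, hN⟩ := exists_nat_one_div_lt hη
  refine ⟨N, fun n hn ↦ ?_⟩
  have hn0 : (0 : ℝ) < n + 1 := by positivity
  have hstep : 1 / ((n : ℝ) + 1) < η := lt_of_le_of_lt (by gcongr) hN
  have hsum := intervalIntegral.sum_integral_adjacent_intervals (f := f) (μ := volume)
    (a := fun k : ℕ ↦ (k : ℝ) / (n + 1)) (n := r n) fun k _ ↦ hf.intervalIntegrable _ _
  simp only [Nat.cast_zero, zero_div] at hsum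
  rw [dist_zero_right, Real.norm_of_nonneg dist_nonneg, Real.dist_eq, ← hsum, Finset.mul_sum,
    ← Finset.sum_sub_distrib]
  have hterm : ∀ k ∈ Finset.range (r n),
      |(∫ s in ((k : ℝ) / (n + 1))..((k + 1 : ℕ) : ℝ) / (n + 1), f s) -
        1 / ((n : ℝ) + 1) * f (k / (n + 1))| ≤ ε / (R + 1) * (1 / (n + 1)) := by
    intro k hk
    have hlen : ((k + 1 : ℕ) : ℝ) / (n + 1) - k / (n + 1) = 1 / (n + 1) := by push_cast; ring
    have hle : (k : ℝ) / (n + 1) ≤ ((k + 1 : ℕ) : ℝ) / (n + 1) := by gcongr; simp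
    have hkR : ((k + 1 : ℕ) : ℝ) / (n + 1) ≤ R := by
      refine le_trans ?_ (hR' n)
      gcongr
      exact Finset.mem_range.1 hk
    have hk0 : 0 ≤ (k : ℝ) / (n + 1) := by positivity
    have hconst : 1 / ((n : ℝ) + 1) * f (k / (n + 1)) =
        ∫ s in ((k : ℝ) / (n + 1))..((k + 1 : ℕ) : ℝ) / (n + 1), f (k / (n + 1)) := by
      rw [intervalIntegral.integral_const, hlen, smul_eq_mul]
    rw [hconst, ← intervalIntegral.integral_sub (hf.intervalIntegrable _ _) (by simp),
      ← Real.norm_eq_abs]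
    refine (intervalIntegral.norm_integral_le_of_norm_le_const (C := ε / (R + 1)) ?_).trans ?_
    · intro x hx
      rw [Set.uIoc_of_le hle] at hx
      refine (hu x ⟨hk0.trans hx.1.le, hx.2.trans hkR⟩ _ ⟨hk0, hle.trans hkR⟩ ?_).le
      rw [Real.dist_eq, abs_of_nonneg (by linarith [hx.1])]
      linarith [hx.2]
    · rw [hlen, abs_of_pos (by positivity)]
  calc _ ≤ ∑ k ∈ Finset.range (r n), ε / (R + 1) * (1 / (n + 1)) :=
        (Finset.abs_sum_le_sum_abs _ _).trans (Finset.sum_le_sum hterm)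
    _ = ε * ((r n : ℝ) / (n + 1) / (R + 1)) := by
        rw [Finset.sum_const, Finset.card_range, nsmul_eq_mul]; ring
    _ < ε * 1 := by
        gcongr
        rw [div_lt_one (by positivity)]
        linarith [hR' n]
    _ = ε := mul_one ε

/-! ### Hitting times of continuous paths and their measurability. -/

section Hitting

variable {Ω : Type*} {X : ℝ≥0 → Ω → ℝ} {a : ℝ} {ω : Ω}

lemma apply_eq_of_levelHittingTime_eq (hc : Continuous (X · ω)) {t : ℝ≥0}
    (ht : levelHittingTime X a ω = t) : X t ω = a := by
  have hne : hittingAfter X {a} 0 ω ≠ ⊤ := by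
    rw [← levelHittingTime, ht]; exact WithTop.coe_ne_top
  rw [ne_eq, hittingAfter_eq_top_iff] at hne
  push Not at hne
  obtain ⟨j, hj0, hj⟩ := hne
  have hex : ∃ j, 0 ≤ j ∧ X j ω ∈ ({a} : Set ℝ) := ⟨j, hj0, hj⟩
  rw [levelHittingTime, hittingAfter, if_pos hex, WithTop.coe_inj] at ht
  have hclosed : IsClosed {i : ℝ≥0 | 0 ≤ i ∧ X i ω ∈ ({a} : Set ℝ)} := by
    simpa using isClosed_eq hc continuous_const
  have := hclosed.csInf_mem hex (OrderBot.bddBelow _)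
  rw [ht] at this
  exact this.2

/-- By the intermediate value theorem, a path from `0` cannot reach a value at or above `a` without
having met `a`. -/
lemma coe_lt_levelHittingTime_iff (hc : Continuous (X · ω)) (h0 : X 0 ω = 0) (ha : 0 < a)
    {s : ℝ≥0} : (s : WithTop ℝ≥0) < levelHittingTime X a ω ↔ ∀ u ≤ s, X u ω < a := by
  constructor
  · intro hs u hu
    by_contra! hau
    obtain ⟨v, hv, hva⟩ := intermediate_value_Icc (zero_le (a := u)) hc.continuousOn
      (show a ∈ Set.Icc (X 0 ω) (X u ω) from ⟨h0 ▸ ha.le, hau⟩)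
    exact notMem_of_lt_hittingAfter ((WithTop.coe_le_coe.2 (hv.2.trans hu)).trans_lt hs)
      zero_le hva
  · intro h
    by_contra! hT
    obtain ⟨t, ht, hts⟩ := WithTop.le_coe_iff.1 hT
    exact (h t hts).ne (apply_eq_of_levelHittingTime_eq hc ht)

/-- The minimum of a time `K` and of the first hitting time of the level `a`. -/
noncomputable def truncatedHittingTime (X : ℝ≥0 → Ω → ℝ) (a : ℝ) (K : ℝ≥0) (ω : Ω) : ℝ≥0 :=
  (min (levelHittingTime X a ω) K).untopD 0

lemma coe_truncatedHittingTime (K : ℝ≥0) :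
    (truncatedHittingTime X a K ω : WithTop ℝ≥0) = min (levelHittingTime X a ω) K := by
  have h : min (levelHittingTime X a ω) K ≠ ⊤ :=
    ne_top_of_le_ne_top WithTop.coe_ne_top (min_le_right _ _)
  obtain ⟨t, ht⟩ := WithTop.ne_top_iff_exists.1 h
  rw [truncatedHittingTime, ← ht, WithTop.untopD_coe]

lemma lt_truncatedHittingTime_iff {K s : ℝ≥0} :
    s < truncatedHittingTime X a K ω ↔ s < levelHittingTime X a ω ∧ s < K := by
  rw [← WithTop.coe_lt_coe, coe_truncatedHittingTime, lt_min_iff, WithTop.coe_lt_coe]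

lemma truncatedHittingTime_le (K : ℝ≥0) : truncatedHittingTime X a K ω ≤ K := by
  rw [← WithTop.coe_le_coe, coe_truncatedHittingTime]
  exact min_le_right _ _

lemma truncatedHittingTime_of_le {K : ℝ≥0} (h : levelHittingTime X a ω ≤ K) :
    (truncatedHittingTime X a K ω : ℝ) = levelHittingTimeReal X a ω := by
  rw [truncatedHittingTime, min_eq_left h, levelHittingTimeReal]

lemma truncatedHittingTime_of_ge {K : ℝ≥0} (h : K ≤ levelHittingTime X a ω) :
    truncatedHittingTime X a K ω = K := by
  rw [truncatedHittingTime, min_eq_right h, WithTop.untopD_coe]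

lemma apply_truncatedHittingTime_le (hc : Continuous (X · ω)) (h0 : X 0 ω = 0) (ha : 0 < a)
    (K : ℝ≥0) : X (truncatedHittingTime X a K ω) ω ≤ a := by
  rcases le_or_gt (levelHittingTime X a ω) K with h | h
  · have := coe_truncatedHittingTime (X := X) (a := a) (ω := ω) K
    rw [min_eq_left h] at this
    exact (apply_eq_of_levelHittingTime_eq hc this.symm).le
  · rw [truncatedHittingTime_of_ge h.le]
    exact ((coe_lt_levelHittingTime_iff hc h0 ha).1 h K le_rfl).le

/-- The σ-algebra generated by a process up to time `t`. -/
abbrev pastSigma (X : ℝ≥0 → Ω → ℝ) (t : ℝ≥0) : MeasurableSpace Ω :=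
  MeasurableSpace.comap (fun ω (u : Set.Iic t) ↦ X u ω) inferInstance

lemma measurable_pastSigma {u t : ℝ≥0} (hut : u ≤ t) : Measurable[pastSigma X t] (X u) :=
  (measurable_pi_apply (⟨u, hut⟩ : Set.Iic t)).comp
    (comap_measurable (fun ω (u : Set.Iic t) ↦ X u ω))

lemma pastSigma_le [m : MeasurableSpace Ω] (hX : ∀ t, Measurable (X t)) (t : ℝ≥0) :
    pastSigma X t ≤ m :=
  (measurable_pi_lambda _ fun u : Set.Iic t ↦ hX u).comap_le

/-- By compactness, staying below `a` on `[0, t]` means staying below it with a uniform gap `1 / (m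
+ 1)`, and by continuity a countable dense set of times detects this. The event thus belongs to the
raw past at time `t`, without any completion. -/
lemma measurableSet_coe_lt_levelHittingTime (hc : ∀ ω, Continuous (X · ω)) (h0 : ∀ ω, X 0 ω = 0)
    (ha : 0 < a) (t : ℝ≥0) :
    MeasurableSet[pastSigma X t] {ω | (t : WithTop ℝ≥0) < levelHittingTime X a ω} := by
  have : Nonempty (Set.Iic t) := ⟨⟨t, Set.self_mem_Iic⟩⟩
  have heq : {ω | (t : WithTop ℝ≥0) < levelHittingTime X a ω} =
      ⋃ m : ℕ, ⋂ i : ℕ, {ω | X (TopologicalSpace.denseSeq (Set.Iic t) i) ω ≤ a - 1 / (m + 1)} := by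
    ext ω
    simp only [Set.mem_ofPred_eq, Set.mem_iUnion, Set.mem_iInter,
      coe_lt_levelHittingTime_iff (hc ω) (h0 ω) ha]
    constructor
    · intro h
      have hcomp : IsCompact (Set.Iic t) := by
        rw [← Set.Icc_bot]; exact isCompact_Icc
      obtain ⟨v, hv, hmax⟩ := hcomp.exists_isMaxOn ⟨t, Set.self_mem_Iic⟩ (hc ω).continuousOn
      obtain ⟨m, hm⟩ := exists_nat_one_div_lt (sub_pos.2 (h v hv))
      refine ⟨m, fun i ↦ ?_⟩
      have := hmax (TopologicalSpace.denseSeq (Set.Iic t) i).2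
      simp only [Set.mem_ofPred_eq] at this
      linarith
    · rintro ⟨m, hm⟩ u hu
      have hcl : IsClosed {u : Set.Iic t | X u ω ≤ a - 1 / (m + 1)} :=
        isClosed_le ((hc ω).comp continuous_subtype_val) continuous_const
      have huniv : {u : Set.Iic t | X u ω ≤ a - 1 / (m + 1)} = Set.univ := by
        refine hcl.closure_eq ▸ ((TopologicalSpace.denseRange_denseSeq (Set.Iic t)).mono ?_).closure_eq
        rintro _ ⟨i, rfl⟩
        exact hm i
      have : X u ω ≤ a - 1 / (m + 1) := huniv.ge (Set.mem_univ (⟨u, hu⟩ : Set.Iic t))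
      have hpos : (0 : ℝ) < 1 / (m + 1) := by positivity
      linarith
  rw [heq]
  refine MeasurableSet.iUnion fun m ↦ MeasurableSet.iInter fun i ↦ ?_
  exact (measurable_pastSigma (TopologicalSpace.denseSeq (Set.Iic t) i).2) measurableSet_Iic

end Hitting

/-- A pre-Brownian motion with measurable marginals, all of whose paths are continuous
and start at `0`. -/
structure IsRegularBrownian {Ω : Type*} [MeasurableSpace Ω] (B : ℝ≥0 → Ω → ℝ) (P : Measure Ω) :
    Prop extends IsPreBrownianReal B P where
  measurable : ∀ t, Measurable (B t)
  continuous : ∀ ω, Continuous (B · ω)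
  zero : ∀ ω, B 0 ω = 0

/-! ### Optional stopping for discrete processes at bounded times. -/

section Stopped

variable {Ω : Type*}

lemma stopped_eq_add_sum (N : ℕ → Ω → ℝ) {ρ : Ω → ℕ} {m : ℕ} (hρ : ∀ ω, ρ ω ≤ m) (ω : Ω) :
    N (ρ ω) ω = N 0 ω +
      ∑ k ∈ Finset.range m, {ω | k < ρ ω}.indicator (fun ω ↦ N (k + 1) ω - N k ω) ω := by
  have : ∑ k ∈ Finset.range m, {ω | k < ρ ω}.indicator (fun ω ↦ N (k + 1) ω - N k ω) ω =
      ∑ k ∈ Finset.range (ρ ω), (N (k + 1) ω - N k ω) := by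
    simp only [Set.indicator_apply, Set.mem_ofPred_eq]
    rw [← Finset.sum_filter]
    congr 1
    ext k
    have := hρ ω
    simp only [Finset.mem_filter, Finset.mem_range]
    omega
  rw [this, Finset.sum_range_sub (fun k ↦ N k ω)]
  ring

variable [MeasurableSpace Ω] {P : Measure Ω}

lemma HasFiniteMoments.stopped {N : ℕ → Ω → ℝ} {ρ : Ω → ℕ} {m : ℕ} (hρ : ∀ ω, ρ ω ≤ m)
    (hN : ∀ k, HasFiniteMoments (N k) P) (hmeas : ∀ k, MeasurableSet {ω | k < ρ ω}) :
    HasFiniteMoments (fun ω ↦ N (ρ ω) ω) P := by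
  simp_rw [stopped_eq_add_sum N hρ]
  refine (hN 0).add (HasFiniteMoments.sum fun k _ ↦ HasFiniteMoments.indicator ?_ (hmeas k))
  simpa [sub_eq_add_neg] using (hN (k + 1)).add ((hN k).const_mul (-1))

/-- Optional stopping at a bounded time for a discrete process. -/
lemma integral_stopped_eq {N : ℕ → Ω → ℝ} {ρ : Ω → ℕ} {m : ℕ} (hρ : ∀ ω, ρ ω ≤ m)
    (hN : ∀ k, Integrable (N k) P) (hmeas : ∀ k, MeasurableSet {ω | k < ρ ω})
    (h0 : ∀ k, ∫ ω, {ω | k < ρ ω}.indicator (fun ω ↦ N (k + 1) ω - N k ω) ω ∂P = 0) :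
    ∫ ω, N (ρ ω) ω ∂P = ∫ ω, N 0 ω ∂P := by
  simp_rw [stopped_eq_add_sum N hρ]
  have hi k : Integrable ({ω | k < ρ ω}.indicator fun ω ↦ N (k + 1) ω - N k ω) P :=
    ((hN (k + 1)).sub (hN k)).indicator (hmeas k)
  rw [integral_add (hN 0) (integrable_finsetSum _ fun k _ ↦ hi k),
    integral_finsetSum _ fun k _ ↦ hi k, Finset.sum_eq_zero fun k _ ↦ h0 k, add_zero]

end Stopped

/-! ### The two martingales along a grid. -/

section GridMartingales

variable {Ω : Type*} [MeasurableSpace Ω] {P : Measure Ω} {B : ℝ≥0 → Ω → ℝ}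

lemma ProbabilityTheory.IsPreBrownianReal.hasLaw_increment (hB : IsPreBrownianReal B P)
    (t h : ℝ≥0) : HasLaw (fun ω ↦ B (t + h) ω - B t ω) (gaussianReal 0 h) P :=
  (hB.shift t).hasLaw_eval h

lemma ProbabilityTheory.IsPreBrownianReal.indepFun_increment (hB : IsPreBrownianReal B P)
    {t : ℝ≥0} (h : ℝ≥0) {U : Ω → ℝ} (hU : Measurable[pastSigma B t] U) :
    IndepFun U (fun ω ↦ B (t + h) ω - B t ω) P := by
  have h1 : IndepFun (fun ω (u : Set.Iic t) ↦ B u ω) (fun ω ↦ B (t + h) ω - B t ω) P :=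
    (hB.indepFun_shift t).symm.comp measurable_id (measurable_pi_apply h)
  rw [IndepFun_iff_Indep] at h1 ⊢
  exact indep_of_indep_of_le_left h1 hU.comap_le

/-- Independence of the past and the next increment. It reduces each martingale property to the
vanishing of the mean of a function of one Gaussian increment. -/
lemma IsRegularBrownian.integral_indicator_mul_increment (hB : IsRegularBrownian B P)
    {t : ℝ≥0} (h : ℝ≥0) {U : Ω → ℝ} (hU : Measurable[pastSigma B t] U) {s : Set Ω}
    (hs : MeasurableSet[pastSigma B t] s) {φ : ℝ → ℝ} (hφ : Measurable φ) :
    ∫ ω, s.indicator (fun ω ↦ U ω * φ (B (t + h) ω - B t ω)) ω ∂P =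
      (∫ ω, s.indicator U ω ∂P) * ∫ ω, φ (B (t + h) ω - B t ω) ∂P := by
  have hUs : Measurable[pastSigma B t] (s.indicator U) := hU.indicator hs
  have hind := (hB.indepFun_increment h hUs).comp measurable_id hφ
  have hW : Measurable fun ω ↦ φ (B (t + h) ω - B t ω) :=
    hφ.comp ((hB.measurable _).sub (hB.measurable _))
  have := hind.integral_fun_mul_eq_mul_integral
    (hUs.mono (pastSigma_le hB.measurable t) le_rfl).aestronglyMeasurable hW.aestronglyMeasurable
  refine Eq.trans ?_ this
  congr 1 with ω
  by_cases hω : ω ∈ s <;> simp [hω]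

lemma IsRegularBrownian.hasFiniteMoments (hB : IsRegularBrownian B P) (t : ℝ≥0) :
    HasFiniteMoments (B t) P := .of_gaussian (hB.hasLaw_eval t)

/-- The exponential martingale `exp (c B_t - c² t / 2)`. -/
noncomputable def expMart (B : ℝ≥0 → Ω → ℝ) (c : ℝ) (t : ℝ≥0) (ω : Ω) : ℝ :=
  Real.exp (c * B t ω - c ^ 2 * t / 2)

/-- The martingale along the grid of mesh `δ` which compensates the Riemann sums of the path. -/
noncomputable def areaMart (B : ℝ≥0 → Ω → ℝ) (c : ℝ) (δ : ℝ≥0) (k : ℕ) (ω : Ω) : ℝ :=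
  expMart B c (k * δ) ω * (δ * ∑ j ∈ Finset.range k, B (j * δ) ω +
    (-(1 / (2 * c)) * B (k * δ) ω ^ 2 + (1 / (2 * c ^ 2) + δ / 2) * B (k * δ) ω))

/-- The index of the first grid point after the hitting time of `1` truncated at `K`. -/
noncomputable def gridIndex (B : ℝ≥0 → Ω → ℝ) (δ K : ℝ≥0) (ω : Ω) : ℕ :=
  ⌈truncatedHittingTime B 1 K ω / δ⌉₊

/-- Rounding up, rather than down, is what makes `{k < gridIndex}` an event known at the grid time
`k * δ`. -/
lemma lt_gridIndex_iff {Ω : Type*} {B : ℝ≥0 → Ω → ℝ} {δ K : ℝ≥0} (hδ : 0 < δ) {k : ℕ} {ω : Ω} :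
    k < gridIndex B δ K ω ↔ k * δ < truncatedHittingTime B 1 K ω := by
  rw [gridIndex, Nat.lt_ceil, lt_div_iff₀ hδ]

lemma gridIndex_mul_lt {Ω : Type*} {B : ℝ≥0 → Ω → ℝ} {δ : ℝ≥0} (hδ : 0 < δ) (K : ℝ≥0) (ω : Ω) :
    gridIndex B δ K ω * δ < truncatedHittingTime B 1 K ω + δ := by
  have := Nat.ceil_lt_add_one (zero_le (a := truncatedHittingTime B 1 K ω / δ))
  calc _ < (truncatedHittingTime B 1 K ω / δ + 1) * δ := by
        gcongr
        exact this
    _ = _ := by rw [add_mul, one_mul, div_mul_cancel₀ _ hδ.ne']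

lemma le_gridIndex_mul {Ω : Type*} {B : ℝ≥0 → Ω → ℝ} {δ : ℝ≥0} (hδ : 0 < δ) (K : ℝ≥0) (ω : Ω) :
    truncatedHittingTime B 1 K ω ≤ gridIndex B δ K ω * δ := by
  rw [← div_le_iff₀ hδ]
  exact Nat.le_ceil _

lemma gridIndex_le {Ω : Type*} {B : ℝ≥0 → Ω → ℝ} (δ K : ℝ≥0) (ω : Ω) :
    gridIndex B δ K ω ≤ ⌈K / δ⌉₊ :=
  Nat.ceil_mono (by gcongr; exact truncatedHittingTime_le K)

lemma IsRegularBrownian.measurableSet_lt_gridIndex (hB : IsRegularBrownian B P) {δ K : ℝ≥0}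
    (hδ : 0 < δ) (k : ℕ) :
    MeasurableSet[pastSigma B (k * δ)] {ω | k < gridIndex B δ K ω} := by
  have : {ω | k < gridIndex B δ K ω} =
      {ω | ((k * δ : ℝ≥0) : WithTop ℝ≥0) < levelHittingTime B 1 ω} ∩ {_ω | k * δ < K} := by
    ext ω
    simp only [Set.mem_ofPred_eq, Set.mem_inter_iff, lt_gridIndex_iff hδ,
      lt_truncatedHittingTime_iff]
  rw [this]
  exact (measurableSet_coe_lt_levelHittingTime hB.continuous hB.zero one_pos _).inter
    (MeasurableSet.const _)

section Increments

variable (c : ℝ) (δ : ℝ≥0)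

lemma measurable_expMart {Ω : Type*} (B : ℝ≥0 → Ω → ℝ) (t : ℝ≥0) :
    Measurable[pastSigma B t] (expMart B c t) := by
  have := measurable_pastSigma (X := B) (le_refl t)
  unfold expMart
  fun_prop

lemma IsRegularBrownian.hasFiniteMoments_expMart (hB : IsRegularBrownian B P) (t : ℝ≥0) :
    HasFiniteMoments (expMart B c t) P := by
  have := (HasFiniteMoments.exp_of_gaussian (hB.hasLaw_eval t) c).const_mul
    (Real.exp (-(c ^ 2 * t / 2)))
  convert this using 2 with ω
  rw [expMart, ← Real.exp_add]
  ring_nf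

lemma IsRegularBrownian.hasFiniteMoments_areaMart (hB : IsRegularBrownian B P) [IsFiniteMeasure P] (k : ℕ) :
    HasFiniteMoments (areaMart B c δ k) P :=
  (hB.hasFiniteMoments_expMart c _).mul <|
    ((HasFiniteMoments.sum fun _ _ ↦ hB.hasFiniteMoments _).const_mul _).add <|
      (((hB.hasFiniteMoments _).pow 2).const_mul _).add ((hB.hasFiniteMoments _).const_mul _)

lemma IsRegularBrownian.integral_exp_increment (hB : IsRegularBrownian B P) (t : ℝ≥0) :
    ∫ ω, Real.exp (c * (B (t + δ) ω - B t ω) - c ^ 2 * δ / 2) ∂P = 1 := by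
  simp_rw [sub_eq_add_neg _ (c ^ 2 * (δ : ℝ) / 2), Real.exp_add]
  rw [integral_mul_const, integral_exp_mul_gaussian (hB.hasLaw_increment t δ), ← Real.exp_add]
  simp [mul_comm]

lemma IsRegularBrownian.integral_exp_increment_mul (hB : IsRegularBrownian B P) (t : ℝ≥0) :
    ∫ ω, Real.exp (c * (B (t + δ) ω - B t ω) - c ^ 2 * δ / 2) * (B (t + δ) ω - B t ω) ∂P =
      c * δ := by
  simp_rw [sub_eq_add_neg _ (c ^ 2 * (δ : ℝ) / 2), Real.exp_add, mul_right_comm _ (Real.exp _),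
    mul_comm (Real.exp (c * _)) (B _ _ - _)]
  rw [integral_mul_const, integral_id_mul_exp_gaussian (hB.hasLaw_increment t δ), mul_assoc,
    ← Real.exp_add, mul_comm c]
  simp [mul_comm]

lemma IsRegularBrownian.integral_exp_increment_mul_sq (hB : IsRegularBrownian B P) (t : ℝ≥0) :
    ∫ ω, Real.exp (c * (B (t + δ) ω - B t ω) - c ^ 2 * δ / 2) * (B (t + δ) ω - B t ω) ^ 2 ∂P =
      δ + (c * δ) ^ 2 := by
  simp_rw [sub_eq_add_neg _ (c ^ 2 * (δ : ℝ) / 2), Real.exp_add, mul_right_comm _ (Real.exp _),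
    mul_comm (Real.exp (c * _)) ((B _ _ - _) ^ 2)]
  rw [integral_mul_const, integral_sq_mul_exp_gaussian (hB.hasLaw_increment t δ), mul_assoc,
    ← Real.exp_add, mul_comm c]
  simp [mul_comm]

end Increments

lemma expMart_succ {Ω : Type*} (B : ℝ≥0 → Ω → ℝ) (c : ℝ) (δ : ℝ≥0) (k : ℕ) (ω : Ω) :
    expMart B c ((k + 1 : ℕ) * δ) ω = expMart B c (k * δ) ω *
      Real.exp (c * (B (k * δ + δ) ω - B (k * δ) ω) - c ^ 2 * δ / 2) := by
  simp only [expMart]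
  rw [← Real.exp_add, show ((k + 1 : ℕ) : ℝ≥0) * δ = k * δ + δ by push_cast; ring]
  push_cast
  ring_nf

/-- Let `W` be the increment and `E` its normalised exponential. The difference is a sum of three
products of a past factor and a function of `W`, and each of these functions has mean zero because
`E`, `E W`, `E W²` have means `1`, `c δ`, `δ + (c δ)²`. The correction `δ / 2` in the linear
coefficient of `areaMart` makes the third mean vanish exactly, not merely to first order in `δ`. -/
lemma areaMart_succ_sub {Ω : Type*} (B : ℝ≥0 → Ω → ℝ) {c : ℝ} (δ : ℝ≥0) (k : ℕ) (ω : Ω) :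
    areaMart B c δ (k + 1) ω - areaMart B c δ k ω =
      (areaMart B c δ k ω *
        (Real.exp (c * (B (k * δ + δ) ω - B (k * δ) ω) - c ^ 2 * δ / 2) - 1) +
      expMart B c (k * δ) ω * B (k * δ) ω *
        (δ * Real.exp (c * (B (k * δ + δ) ω - B (k * δ) ω) - c ^ 2 * δ / 2) + -(1 / c) *
          (Real.exp (c * (B (k * δ + δ) ω - B (k * δ) ω) - c ^ 2 * δ / 2) *
            (B (k * δ + δ) ω - B (k * δ) ω)))) +
      expMart B c (k * δ) ω *
        (-(1 / (2 * c)) * (Real.exp (c * (B (k * δ + δ) ω - B (k * δ) ω) - c ^ 2 * δ / 2) *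
          (B (k * δ + δ) ω - B (k * δ) ω) ^ 2) + (1 / (2 * c ^ 2) + δ / 2) *
          (Real.exp (c * (B (k * δ + δ) ω - B (k * δ) ω) - c ^ 2 * δ / 2) *
            (B (k * δ + δ) ω - B (k * δ) ω))) := by
  have hk : ((k + 1 : ℕ) : ℝ≥0) * δ = k * δ + δ := by push_cast; ring
  simp only [areaMart, expMart_succ, Finset.sum_range_succ]
  rw [hk]
  generalize Real.exp _ = E
  rw [one_div, one_div, mul_inv]
  ring

/-- Optional stopping for the exponential martingale along a grid. -/
lemma IsRegularBrownian.integral_expMart_gridIndex (hB : IsRegularBrownian B P)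
    [IsProbabilityMeasure P] (c : ℝ) {δ : ℝ≥0} (hδ : 0 < δ) (K : ℝ≥0) :
    ∫ ω, expMart B c (gridIndex B δ K ω * δ) ω ∂P = 1 := by
  have hpast k := hB.measurableSet_lt_gridIndex (K := K) hδ k
  rw [integral_stopped_eq (N := fun k ω ↦ expMart B c (k * δ) ω) (gridIndex_le δ K)
    (fun k ↦ (hB.hasFiniteMoments_expMart c _).integrable)
    (fun k ↦ pastSigma_le hB.measurable _ _ (hpast k)) fun k ↦ ?_]
  · simp [expMart, hB.zero]
  · have h := hB.integral_indicator_mul_increment δ (measurable_expMart c B (k * δ)) (hpast k)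
      (φ := fun w ↦ Real.exp (c * w - c ^ 2 * δ / 2) - 1) (by fun_prop)
    simp_rw [expMart_succ, ← mul_sub_one]
    rw [h, integral_sub, hB.integral_exp_increment]
    · simp
    -- A non-integrable function would have integral `0`, whereas this one has integral `1`.
    · by_contra hcon
      simpa [integral_undef hcon] using hB.integral_exp_increment c δ (k * δ)
    · exact integrable_const _

lemma integral_indicator_add_add {s : Set Ω} (hs : MeasurableSet s) {f g h : Ω → ℝ}
    (hf : Integrable f P) (hg : Integrable g P) (hh : Integrable h P) :
    ∫ ω, s.indicator (fun ω ↦ f ω + g ω + h ω) ω ∂P =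
      ∫ ω, s.indicator f ω ∂P + ∫ ω, s.indicator g ω ∂P + ∫ ω, s.indicator h ω ∂P := by
  simp_rw [integral_indicator hs]
  rw [integral_add (f := fun ω ↦ f ω + g ω) (hf.add hg).integrableOn hh.integrableOn,
    integral_add hf.integrableOn hg.integrableOn]

/-- Optional stopping for the area martingale along a grid. -/
lemma IsRegularBrownian.integral_areaMart_gridIndex (hB : IsRegularBrownian B P)
    [IsProbabilityMeasure P] {c : ℝ} (hc : c ≠ 0) {δ : ℝ≥0} (hδ : 0 < δ) (K : ℝ≥0) :
    ∫ ω, areaMart B c δ (gridIndex B δ K ω) ω ∂P = 0 := by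
  have hpast k := hB.measurableSet_lt_gridIndex (K := K) hδ k
  have hms k : MeasurableSet {ω | k < gridIndex B δ K ω} :=
    pastSigma_le hB.measurable _ _ (hpast k)
  rw [integral_stopped_eq (N := areaMart B c δ) (gridIndex_le δ K)
    (fun k ↦ (hB.hasFiniteMoments_areaMart c δ k).integrable) hms fun k ↦ ?_]
  · simp [areaMart, hB.zero]
  have hE := HasFiniteMoments.exp_of_gaussian (hB.hasLaw_increment (k * δ) δ) c
  have hE' : HasFiniteMoments
      (fun ω ↦ Real.exp (c * (B (k * δ + δ) ω - B (k * δ) ω) - c ^ 2 * δ / 2)) P := by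
    simp_rw [sub_eq_add_neg _ (c ^ 2 * (δ : ℝ) / 2), Real.exp_add]
    exact hE.mul (.const _)
  have hW : HasFiniteMoments (fun ω ↦ B (k * δ + δ) ω - B (k * δ) ω) P :=
    .of_gaussian (hB.hasLaw_increment (k * δ) δ)
  have hEW := hE'.mul hW
  have hEW2 := hE'.mul (hW.pow 2)
  have hM := hB.hasFiniteMoments_expMart c (k * δ)
  have hMB := hM.mul (hB.hasFiniteMoments (k * δ))
  have hA := hB.hasFiniteMoments_areaMart c δ k
  have hMm := measurable_expMart c B (k * δ)
  have hBm := measurable_pastSigma (X := B) (le_refl (k * δ))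
  have hAm : Measurable[pastSigma B (k * δ)] (areaMart B c δ k) := by
    have hS : Measurable[pastSigma B (k * δ)] fun ω ↦ ∑ j ∈ Finset.range k, B (j * δ) ω :=
      Finset.measurable_sum _ fun j hj ↦ measurable_pastSigma (by
        have := (Finset.mem_range.1 hj).le
        gcongr)
    unfold areaMart
    fun_prop
  have hMBm : Measurable[pastSigma B (k * δ)] fun ω ↦ expMart B c (k * δ) ω * B (k * δ) ω :=
    hMm.mul hBm
  have hI1 := (hA.mul (hE'.add (.const (-1)))).integrable
  have hI2 := (hMB.mul ((hE'.const_mul δ).add (hEW.const_mul (-(1 / c))))).integrable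
  have hI3 := (hM.mul ((hEW2.const_mul (-(1 / (2 * c)))).add
    (hEW.const_mul (1 / (2 * c ^ 2) + δ / 2)))).integrable
  simp_rw [← sub_eq_add_neg] at hI1
  simp_rw [areaMart_succ_sub]
  rw [integral_indicator_add_add (hms k) hI1 hI2 hI3,
    hB.integral_indicator_mul_increment δ hAm (hpast k)
        (φ := fun w ↦ Real.exp (c * w - c ^ 2 * δ / 2) - 1) (by fun_prop),
      hB.integral_indicator_mul_increment δ hMBm (hpast k)
        (φ := fun w ↦ δ * Real.exp (c * w - c ^ 2 * δ / 2) + -(1 / c) *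
          (Real.exp (c * w - c ^ 2 * δ / 2) * w)) (by fun_prop),
      hB.integral_indicator_mul_increment δ hMm (hpast k)
        (φ := fun w ↦ -(1 / (2 * c)) * (Real.exp (c * w - c ^ 2 * δ / 2) * w ^ 2) +
          (1 / (2 * c ^ 2) + δ / 2) * (Real.exp (c * w - c ^ 2 * δ / 2) * w)) (by fun_prop),
      integral_sub hE'.integrable (integrable_const _),
      integral_add (hE'.integrable.const_mul _) (hEW.integrable.const_mul _),
      integral_add (hEW2.integrable.const_mul _) (hEW.integrable.const_mul _),
      integral_const_mul, integral_const_mul, integral_const_mul, integral_const_mul,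
      hB.integral_exp_increment, hB.integral_exp_increment_mul, hB.integral_exp_increment_mul_sq]
  have h1 : (δ : ℝ) * 1 + -(1 / c) * (c * δ) = 0 := by field_simp; ring
  have h2 : -(1 / (2 * c)) * ((δ : ℝ) + (c * δ) ^ 2) + (1 / (2 * c ^ 2) + δ / 2) * (c * δ) = 0 := by
    field_simp; ring
  rw [h1, h2]
  simp

end GridMartingales

/-! ### Bounds uniform in the mesh. -/

section GridLimit

variable {Ω : Type*} [MeasurableSpace Ω] {P : Measure Ω} {B : ℝ≥0 → Ω → ℝ}

lemma gridIndex_mul_le {Ω : Type*} {B : ℝ≥0 → Ω → ℝ} {δ : ℝ≥0} (hδ : 0 < δ) (hδ1 : δ ≤ 1)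
    (K : ℝ≥0) (ω : Ω) : gridIndex B δ K ω * δ ≤ K + 1 :=
  (gridIndex_mul_lt hδ K ω).le.trans (by gcongr; exact truncatedHittingTime_le K)

lemma IsRegularBrownian.measurableSet_lt_gridIndex' (hB : IsRegularBrownian B P) {δ K : ℝ≥0}
    (hδ : 0 < δ) (k : ℕ) : MeasurableSet {ω | k < gridIndex B δ K ω} :=
  pastSigma_le hB.measurable _ _ (hB.measurableSet_lt_gridIndex hδ k)

lemma IsRegularBrownian.hasFiniteMoments_exp_gridIndex (hB : IsRegularBrownian B P) (c : ℝ)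
    {δ : ℝ≥0} (hδ : 0 < δ) (K : ℝ≥0) :
    HasFiniteMoments (fun ω ↦ Real.exp (c * B (gridIndex B δ K ω * δ) ω)) P :=
  .stopped (N := fun k ω ↦ Real.exp (c * B (k * δ) ω)) (gridIndex_le δ K)
    (fun _ ↦ .exp_of_gaussian (hB.hasLaw_eval _) c) fun k ↦ hB.measurableSet_lt_gridIndex' hδ k

lemma IsRegularBrownian.hasFiniteMoments_expMart_gridIndex (hB : IsRegularBrownian B P) (c : ℝ)
    {δ : ℝ≥0} (hδ : 0 < δ) (K : ℝ≥0) :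
    HasFiniteMoments (fun ω ↦ expMart B c (gridIndex B δ K ω * δ) ω) P :=
  .stopped (N := fun k ω ↦ expMart B c (k * δ) ω) (gridIndex_le δ K)
    (fun _ ↦ hB.hasFiniteMoments_expMart c _) fun k ↦ hB.measurableSet_lt_gridIndex' hδ k

lemma IsRegularBrownian.hasFiniteMoments_areaMart_gridIndex (hB : IsRegularBrownian B P)
    [IsFiniteMeasure P] (c : ℝ) {δ : ℝ≥0} (hδ : 0 < δ) (K : ℝ≥0) :
    HasFiniteMoments (fun ω ↦ areaMart B c δ (gridIndex B δ K ω) ω) P :=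
  .stopped (gridIndex_le δ K) (fun _ ↦ hB.hasFiniteMoments_areaMart c δ _)
    fun k ↦ hB.measurableSet_lt_gridIndex' hδ k

lemma expMart_le_exp {Ω : Type*} (B : ℝ≥0 → Ω → ℝ) (c : ℝ) (t : ℝ≥0) (ω : Ω) :
    expMart B c t ω ≤ Real.exp (c * B t ω) :=
  Real.exp_le_exp.2 (by have : 0 ≤ c ^ 2 * t / 2 := by positivity
                        linarith)

lemma expMart_pos {Ω : Type*} (B : ℝ≥0 → Ω → ℝ) (c : ℝ) (t : ℝ≥0) (ω : Ω) :
    0 < expMart B c t ω := Real.exp_pos _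

/-- The exponential of the stopped path is the exponential martingale times `exp (c² t / 2)`, and
the stopped grid time is at most `K + 1`. -/
lemma IsRegularBrownian.integral_exp_gridIndex_le (hB : IsRegularBrownian B P)
    [IsProbabilityMeasure P] (c : ℝ) {δ : ℝ≥0} (hδ : 0 < δ) (hδ1 : δ ≤ 1) (K : ℝ≥0) :
    ∫ ω, Real.exp (c * B (gridIndex B δ K ω * δ) ω) ∂P ≤ Real.exp (c ^ 2 * (K + 1) / 2) := by
  calc _ ≤ ∫ ω, expMart B c (gridIndex B δ K ω * δ) ω * Real.exp (c ^ 2 * (K + 1) / 2) ∂P := by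
        refine integral_mono (hB.hasFiniteMoments_exp_gridIndex c hδ K).integrable
          ((hB.hasFiniteMoments_expMart_gridIndex c hδ K).integrable.mul_const _) fun ω ↦ ?_
        simp only [expMart]
        rw [← Real.exp_add, Real.exp_le_exp]
        have h : ((gridIndex B δ K ω * δ : ℝ≥0) : ℝ) ≤ K + 1 := by
          exact_mod_cast gridIndex_mul_le hδ hδ1 K ω
        nlinarith [sq_nonneg c, mul_le_mul_of_nonneg_left h (sq_nonneg c)]
    _ = _ := by rw [integral_mul_const, hB.integral_expMart_gridIndex c hδ K, one_mul]

/-- Square `x ≤ 2 sinh (x / 2)`, for `x ≥ 0`. -/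
lemma sq_le_exp_add_exp_neg (x : ℝ) : x ^ 2 ≤ Real.exp x + Real.exp (-x) := by
  wlog hx : 0 ≤ x generalizing x
  · simpa [add_comm] using this (-x) (by linarith)
  have h := Real.self_le_sinh_iff.2 (by linarith : 0 ≤ x / 2)
  rw [Real.sinh_eq] at h
  have h1 : Real.exp x = Real.exp (x / 2) ^ 2 := by rw [← Real.exp_nat_mul]; ring_nf
  have h2 : Real.exp (-x) = Real.exp (-(x / 2)) ^ 2 := by rw [← Real.exp_nat_mul]; ring_nf
  have h3 : Real.exp (x / 2) * Real.exp (-(x / 2)) = 1 := by rw [← Real.exp_add]; simp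
  rw [h1, h2]
  nlinarith

lemma abs_le_exp_add_exp_neg (x : ℝ) : |x| ≤ Real.exp x + Real.exp (-x) := by
  have h1 := Real.add_one_le_exp x
  have h2 := Real.add_one_le_exp (-x)
  have h3 := Real.exp_pos x
  have h4 := Real.exp_pos (-x)
  rw [abs_le]
  constructor <;> linarith

lemma exp_add_exp_neg_sq_le (x : ℝ) :
    (Real.exp x + Real.exp (-x)) ^ 2 ≤ 2 * (Real.exp (2 * x) + Real.exp (-2 * x)) := by
  have h1 : Real.exp (2 * x) = Real.exp x ^ 2 := by rw [← Real.exp_nat_mul]; simp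
  have h2 : Real.exp (-2 * x) = Real.exp (-x) ^ 2 := by rw [← Real.exp_nat_mul]; simp
  rw [h1, h2]
  nlinarith [sq_nonneg (Real.exp x - Real.exp (-x))]

lemma IsRegularBrownian.integral_pow_four_le (hB : IsRegularBrownian B P) (t : ℝ≥0) :
    ∫ ω, B t ω ^ 4 ∂P ≤ 4 * Real.exp (2 * t) := by
  have h1 := (HasFiniteMoments.exp_of_gaussian (hB.hasLaw_eval t) 2).integrable
  have h2 := (HasFiniteMoments.exp_of_gaussian (hB.hasLaw_eval t) (-2)).integrable
  calc _ ≤ ∫ ω, 2 * (Real.exp (2 * B t ω) + Real.exp (-2 * B t ω)) ∂P := by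
        refine integral_mono_of_nonneg (ae_of_all _ fun ω ↦ by positivity)
          ((h1.add h2).const_mul 2) (ae_of_all _ fun ω ↦ ?_)
        refine le_trans ?_ (exp_add_exp_neg_sq_le (B t ω))
        calc B t ω ^ 4 = (B t ω ^ 2) ^ 2 := by ring
          _ ≤ _ := by gcongr; exact sq_le_exp_add_exp_neg _
    _ = _ := by
        rw [integral_const_mul, integral_add h1 h2, integral_exp_mul_gaussian (hB.hasLaw_eval t),
          integral_exp_mul_gaussian (hB.hasLaw_eval t)]
        ring_nf

/-- The power mean inequality costs a factor `m³`, absorbed by `δ⁴` together with the `m` terms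
since `m δ ≤ K + 1`. -/
lemma IsRegularBrownian.integral_sum_abs_pow_four_le (hB : IsRegularBrownian B P)
    [IsProbabilityMeasure P] {δ K : ℝ≥0} {m : ℕ} (hm : m * δ ≤ K + 1) :
    ∫ ω, (δ * ∑ j ∈ Finset.range m, |B (j * δ) ω|) ^ 4 ∂P ≤
      (K + 1) ^ 4 * (4 * Real.exp (2 * (K + 1))) := by
  have hint (j : ℕ) : Integrable (fun ω ↦ B (j * δ) ω ^ 4) P :=
    ((hB.hasFiniteMoments _).pow 4).integrable
  have hm' : (m : ℝ) * δ ≤ K + 1 := by exact_mod_cast hm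
  have hsum : Integrable (fun ω ↦ ∑ j ∈ Finset.range m, B (j * δ) ω ^ 4) P :=
    integrable_finsetSum _ fun j _ ↦ hint j
  calc _ ≤ ∫ ω, (δ : ℝ) ^ 4 * (m ^ 3 * ∑ j ∈ Finset.range m, B (j * δ) ω ^ 4) ∂P := by
        refine integral_mono_of_nonneg (ae_of_all _ fun ω ↦ by positivity)
          ((hsum.const_mul ((m : ℝ) ^ 3)).const_mul ((δ : ℝ) ^ 4))
          (ae_of_all _ fun ω ↦ ?_)
        simp only [mul_pow]
        gcongr
        rcases Nat.eq_zero_or_pos m with rfl | hpos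
        · simp
        have h := pow_sum_div_card_le_sum_pow (s := Finset.range m)
          (f := fun j ↦ |B (j * δ) ω|) (fun _ _ ↦ abs_nonneg _) 3
        rw [Finset.card_range, div_le_iff₀ (by positivity)] at h
        have h4 (x : ℝ) : |x| ^ 4 = x ^ 4 := Even.pow_abs (by decide) x
        simp only [Nat.reduceAdd, h4] at h
        linarith
    _ = (δ : ℝ) ^ 4 * (m ^ 3 * ∑ j ∈ Finset.range m, ∫ ω, B (j * δ) ω ^ 4 ∂P) := by
        rw [integral_const_mul, integral_const_mul, integral_finsetSum _ fun j _ ↦ hint j]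
    _ ≤ (δ : ℝ) ^ 4 * (m ^ 3 * ∑ j ∈ Finset.range m, 4 * Real.exp (2 * (K + 1))) := by
        gcongr with j hj
        refine (hB.integral_pow_four_le _).trans ?_
        gcongr
        push_cast
        refine le_trans ?_ hm'
        gcongr
        exact (Finset.mem_range.1 hj).le
    _ = (m * δ : ℝ) ^ 4 * (4 * Real.exp (2 * (K + 1))) := by
        rw [Finset.sum_const, Finset.card_range, nsmul_eq_mul]; ring
    _ ≤ _ := by gcongr

/-- The random range of summation is enlarged to a deterministic one, the polynomial in the stopped
value is dominated by exponentials, and `2ab ≤ a² + b²` separates the exponential from the Riemann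
sum. Every remaining term has a mean bounded independently of `δ`. -/
lemma areaMart_gridIndex_sq_le {Ω : Type*} {B : ℝ≥0 → Ω → ℝ} (c : ℝ) {δ : ℝ≥0}
    (hδ1 : δ ≤ 1) (K : ℝ≥0) (ω : Ω) :
    areaMart B c δ (gridIndex B δ K ω) ω ^ 2 ≤
      Real.exp (4 * c * B (gridIndex B δ K ω * δ) ω) +
      (δ * ∑ j ∈ Finset.range ⌈K / δ⌉₊, |B (j * δ) ω|) ^ 4 +
      4 * (|1 / (2 * c)| + (1 / (2 * c ^ 2) + 1 / 2)) ^ 2 *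
        (Real.exp ((2 * c + 2) * B (gridIndex B δ K ω * δ) ω) +
          Real.exp ((2 * c - 2) * B (gridIndex B δ K ω * δ) ω)) := by
  set ρ := gridIndex B δ K ω
  set x := B (ρ * δ) ω
  set S := (δ : ℝ) * ∑ j ∈ Finset.range ⌈K / δ⌉₊, |B (j * δ) ω|
  set σ := (δ : ℝ) * ∑ j ∈ Finset.range ρ, B (j * δ) ω
  set D := |1 / (2 * c)| + (1 / (2 * c ^ 2) + 1 / 2)
  set u := Real.exp x + Real.exp (-x) with hu
  have hδ' : (δ : ℝ) ≤ 1 := by exact_mod_cast hδ1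
  have hσ : |σ| ≤ S := by
    rw [abs_mul, abs_of_nonneg δ.coe_nonneg]
    refine mul_le_mul_of_nonneg_left ?_ δ.coe_nonneg
    refine (Finset.abs_sum_le_sum_abs _ _).trans
      (Finset.sum_le_sum_of_subset_of_nonneg ?_ fun _ _ _ ↦ abs_nonneg _)
    exact Finset.range_subset_range.2 (gridIndex_le δ K ω)
  have hpoly : |-(1 / (2 * c)) * x ^ 2 + (1 / (2 * c ^ 2) + δ / 2) * x| ≤ D * u := by
    refine (abs_add_le _ _).trans ?_
    rw [abs_mul, abs_mul, abs_neg, abs_of_nonneg (sq_nonneg x),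
      abs_of_nonneg (show 0 ≤ 1 / (2 * c ^ 2) + (δ : ℝ) / 2 by positivity)]
    refine (add_le_add (mul_le_mul_of_nonneg_left (sq_le_exp_add_exp_neg x) (abs_nonneg _))
      (mul_le_mul ?_ (abs_le_exp_add_exp_neg x) (abs_nonneg _)
        (show (0 : ℝ) ≤ 1 / (2 * c ^ 2) + 1 / 2 by positivity))).trans (add_mul _ _ u).ge
    gcongr
  have hD : 0 ≤ D := by positivity
  have hu0 : 0 ≤ u := by positivity
  have hS : 0 ≤ S := by positivity
  have hM0 := (expMart_pos B c (ρ * δ) ω).le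
  have hM := expMart_le_exp B c (ρ * δ) ω
  have hsum : |σ + (-(1 / (2 * c)) * x ^ 2 + (1 / (2 * c ^ 2) + δ / 2) * x)| ≤ S + D * u :=
    (abs_add_le _ _).trans (add_le_add hσ hpoly)
  have hexp2 : Real.exp (c * x) ^ 2 * (2 * (Real.exp (2 * x) + Real.exp (-2 * x))) =
      2 * (Real.exp ((2 * c + 2) * x) + Real.exp ((2 * c - 2) * x)) := by
    rw [← Real.exp_nat_mul, mul_left_comm, mul_add, ← Real.exp_add, ← Real.exp_add]
    push_cast
    ring_nf
  have hexp4 : Real.exp (4 * c * x) = (Real.exp (c * x) ^ 2) ^ 2 := by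
    rw [← pow_mul, ← Real.exp_nat_mul]
    push_cast
    ring_nf
  calc areaMart B c δ ρ ω ^ 2
      = expMart B c (ρ * δ) ω ^ 2 *
        |σ + (-(1 / (2 * c)) * x ^ 2 + (1 / (2 * c ^ 2) + δ / 2) * x)| ^ 2 := by
        rw [sq_abs, ← mul_pow, areaMart]
    _ ≤ Real.exp (c * x) ^ 2 * (S + D * u) ^ 2 := by gcongr
    _ ≤ Real.exp (c * x) ^ 2 * (2 * S ^ 2 + 2 * D ^ 2 * u ^ 2) := by
        gcongr
        nlinarith [sq_nonneg (S - D * u)]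
    _ = 2 * Real.exp (c * x) ^ 2 * S ^ 2 + 2 * D ^ 2 * (Real.exp (c * x) ^ 2 * u ^ 2) := by ring
    _ ≤ (Real.exp (c * x) ^ 2) ^ 2 + S ^ 4 + 2 * D ^ 2 *
        (2 * (Real.exp ((2 * c + 2) * x) + Real.exp ((2 * c - 2) * x))) := by
        refine add_le_add ?_ ?_
        · nlinarith [sq_nonneg (Real.exp (c * x) ^ 2 - S ^ 2)]
        · rw [← hexp2]
          gcongr
          exact exp_add_exp_neg_sq_le x
    _ = _ := by rw [hexp4]; ring

lemma IsRegularBrownian.exists_integral_areaMart_sq_le (hB : IsRegularBrownian B P)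
    [IsProbabilityMeasure P] (c : ℝ) (K : ℝ≥0) :
    ∃ C : ℝ, ∀ δ : ℝ≥0, 0 < δ → δ ≤ 1 →
      ∫ ω, areaMart B c δ (gridIndex B δ K ω) ω ^ 2 ∂P ≤ C := by
  refine ⟨Real.exp ((4 * c) ^ 2 * (K + 1) / 2) + (K + 1) ^ 4 * (4 * Real.exp (2 * (K + 1))) +
    4 * (|1 / (2 * c)| + (1 / (2 * c ^ 2) + 1 / 2)) ^ 2 *
      (Real.exp ((2 * c + 2) ^ 2 * (K + 1) / 2) + Real.exp ((2 * c - 2) ^ 2 * (K + 1) / 2)),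
    fun δ hδ hδ1 ↦ ?_⟩
  have hm : (⌈K / δ⌉₊ : ℝ≥0) * δ ≤ K + 1 := by
    have := (Nat.ceil_lt_add_one (zero_le (a := K / δ))).le
    calc _ ≤ (K / δ + 1) * δ := by gcongr
      _ = K + δ := by rw [add_mul, one_mul, div_mul_cancel₀ _ hδ.ne']
      _ ≤ K + 1 := by gcongr
  have h1 := (hB.hasFiniteMoments_exp_gridIndex (4 * c) hδ K).integrable
  have h2 := (hB.hasFiniteMoments_exp_gridIndex (2 * c + 2) hδ K).integrable
  have h3 := (hB.hasFiniteMoments_exp_gridIndex (2 * c - 2) hδ K).integrable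
  have hS : Integrable
      (fun ω ↦ ((δ : ℝ) * ∑ j ∈ Finset.range ⌈K / δ⌉₊, |B (j * δ) ω|) ^ 4) P :=
    (((HasFiniteMoments.sum fun j _ ↦ (hB.hasFiniteMoments _).abs).const_mul _).pow 4).integrable
  have h23 := (h2.add h3).const_mul (4 * (|1 / (2 * c)| + (1 / (2 * c ^ 2) + 1 / 2)) ^ 2)
  refine (integral_mono_of_nonneg (ae_of_all _ fun ω ↦ sq_nonneg _) ((h1.add hS).add h23)
    (ae_of_all _ (areaMart_gridIndex_sq_le c hδ1 K))).trans ?_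
  rw [integral_add' (h1.add hS) h23, integral_add' h1 hS, integral_const_mul, integral_add' h2 h3]
  gcongr
  · exact hB.integral_exp_gridIndex_le _ hδ hδ1 K
  · exact hB.integral_sum_abs_pow_four_le hm
  · exact hB.integral_exp_gridIndex_le _ hδ hδ1 K
  · exact hB.integral_exp_gridIndex_le _ hδ hδ1 K

end GridLimit

/-! ### Letting the mesh tend to zero. -/

section ContinuousStopping

variable {Ω : Type*} [MeasurableSpace Ω] {P : Measure Ω} {B : ℝ≥0 → Ω → ℝ}

lemma tendsto_gridIndex_mul {Ω : Type*} (B : ℝ≥0 → Ω → ℝ) (K : ℝ≥0) (ω : Ω) :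
    Tendsto (fun n : ℕ ↦ (gridIndex B (1 / ((n : ℝ≥0) + 1)) K ω : ℝ≥0) * (1 / ((n : ℝ≥0) + 1)))
      atTop (𝓝 (truncatedHittingTime B 1 K ω)) := by
  have hpos (n : ℕ) : 0 < 1 / ((n : ℝ≥0) + 1) := by positivity
  have hlim : Tendsto (fun n : ℕ ↦ truncatedHittingTime B 1 K ω + 1 / ((n : ℝ≥0) + 1)) atTop
      (𝓝 (truncatedHittingTime B 1 K ω)) := by
    have : Tendsto (fun n : ℕ ↦ 1 / ((n : ℝ≥0) + 1)) atTop (𝓝 0) :=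
      tendsto_one_div_add_atTop_nhds_zero_nat
    simpa using this.const_add (truncatedHittingTime B 1 K ω)
  exact tendsto_of_tendsto_of_tendsto_of_le_of_le tendsto_const_nhds hlim
    (fun n ↦ le_gridIndex_mul (hpos n) K ω) fun n ↦ (gridIndex_mul_lt (hpos n) K ω).le

lemma IsRegularBrownian.tendsto_expMart_gridIndex (hB : IsRegularBrownian B P) (c : ℝ) (K : ℝ≥0)
    (ω : Ω) :
    Tendsto (fun n : ℕ ↦ expMart B c
      (gridIndex B (1 / ((n : ℝ≥0) + 1)) K ω * (1 / ((n : ℝ≥0) + 1))) ω) atTop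
      (𝓝 (expMart B c (truncatedHittingTime B 1 K ω) ω)) := by
  have hcont : Continuous fun t : ℝ≥0 ↦ expMart B c t ω := by
    have := hB.continuous ω
    unfold expMart
    fun_prop
  exact (hcont.tendsto _).comp (tendsto_gridIndex_mul B K ω)

/-- The stopped area martingale in continuous time. -/
noncomputable def stoppedArea (B : ℝ≥0 → Ω → ℝ) (c : ℝ) (K : ℝ≥0) (ω : Ω) : ℝ :=
  expMart B c (truncatedHittingTime B 1 K ω) ω *
    ((∫ s in (0 : ℝ)..truncatedHittingTime B 1 K ω, B s.toNNReal ω) +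
      (-(1 / (2 * c)) * B (truncatedHittingTime B 1 K ω) ω ^ 2 +
        1 / (2 * c ^ 2) * B (truncatedHittingTime B 1 K ω) ω))

lemma IsRegularBrownian.tendsto_areaMart_gridIndex (hB : IsRegularBrownian B P) (c : ℝ) (K : ℝ≥0)
    (ω : Ω) :
    Tendsto (fun n : ℕ ↦ areaMart B c (1 / ((n : ℝ≥0) + 1))
      (gridIndex B (1 / ((n : ℝ≥0) + 1)) K ω) ω) atTop (𝓝 (stoppedArea B c K ω)) := by
  have hρ := tendsto_gridIndex_mul B K ω
  have hBρ := ((hB.continuous ω).tendsto _).comp hρ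
  have hmesh : Tendsto (fun n : ℕ ↦ 1 / (2 * c ^ 2) + ((1 / ((n : ℝ≥0) + 1) : ℝ≥0) : ℝ) / 2) atTop
      (𝓝 (1 / (2 * c ^ 2))) := by
    have : Tendsto (fun n : ℕ ↦ 1 / ((n : ℝ) + 1)) atTop (𝓝 0) :=
      tendsto_one_div_add_atTop_nhds_zero_nat
    have h := (this.div_const 2).const_add (1 / (2 * c ^ 2))
    rw [zero_div, add_zero] at h
    exact h.congr fun n ↦ by push_cast; rfl
  refine (hB.tendsto_expMart_gridIndex c K ω).mul (Tendsto.add ?_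
    (((hBρ.pow 2).const_mul _).add (hmesh.mul hBρ)))
  have hr : Tendsto (fun n : ℕ ↦ (gridIndex B (1 / ((n : ℝ≥0) + 1)) K ω : ℝ) / (n + 1)) atTop
      (𝓝 (truncatedHittingTime B 1 K ω)) := by
    have := (NNReal.continuous_coe.tendsto _).comp hρ
    refine this.congr fun n ↦ ?_
    simp [div_eq_mul_inv]
  have hf : Continuous fun s : ℝ ↦ B s.toNNReal ω :=
    (hB.continuous ω).comp continuous_real_toNNReal
  refine (tendsto_riemann_sum hf hr).congr fun n ↦ ?_
  have htime (j : ℕ) : ((j : ℝ) / (n + 1)).toNNReal = j * (1 / ((n : ℝ≥0) + 1)) := by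
    rw [← Real.toNNReal_coe (r := j * (1 / ((n : ℝ≥0) + 1)))]
    congr 1
    push_cast
    ring
  simp_rw [htime]
  push_cast
  rfl

lemma IsRegularBrownian.aestronglyMeasurable_expMart_truncated (hB : IsRegularBrownian B P)
    (c : ℝ) (K : ℝ≥0) :
    AEStronglyMeasurable (fun ω ↦ expMart B c (truncatedHittingTime B 1 K ω) ω) P :=
  aestronglyMeasurable_of_tendsto_ae atTop
    (fun n ↦ (hB.hasFiniteMoments_expMart_gridIndex c (by positivity) K).integrable.1)
    (ae_of_all _ fun ω ↦ hB.tendsto_expMart_gridIndex c K ω)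

variable [IsProbabilityMeasure P]

lemma IsRegularBrownian.aestronglyMeasurable_stoppedArea (hB : IsRegularBrownian B P)
    (c : ℝ) (K : ℝ≥0) : AEStronglyMeasurable (stoppedArea B c K) P :=
  aestronglyMeasurable_of_tendsto_ae atTop
    (fun n ↦ (hB.hasFiniteMoments_areaMart_gridIndex c (by positivity) K).integrable.1)
    (ae_of_all _ fun ω ↦ hB.tendsto_areaMart_gridIndex c K ω)

lemma one_div_nat_add_one_le_one (n : ℕ) : 1 / ((n : ℝ≥0) + 1) ≤ 1 := by
  rw [div_le_one (by positivity)]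
  simp

lemma IsRegularBrownian.integral_expMart_truncated (hB : IsRegularBrownian B P)
    (c : ℝ) (K : ℝ≥0) : ∫ ω, expMart B c (truncatedHittingTime B 1 K ω) ω ∂P = 1 := by
  have hpos (n : ℕ) : 0 < 1 / ((n : ℝ≥0) + 1) := by positivity
  refine tendsto_nhds_unique (tendsto_integral_of_integral_sq_le
    (C := Real.exp ((2 * c) ^ 2 * (K + 1) / 2))
    (fun n ↦ (hB.hasFiniteMoments_expMart_gridIndex c (hpos n) K).integrable.1)
    (fun n ↦ ((hB.hasFiniteMoments_expMart_gridIndex c (hpos n) K).pow 2).integrable)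
    (fun n ↦ ?_) (ae_of_all _ fun ω ↦ hB.tendsto_expMart_gridIndex c K ω)) ?_
  · refine le_trans ?_ (hB.integral_exp_gridIndex_le (2 * c) (hpos n)
      (one_div_nat_add_one_le_one n) K)
    refine integral_mono_of_nonneg (ae_of_all _ fun ω ↦ sq_nonneg _)
      (hB.hasFiniteMoments_exp_gridIndex (2 * c) (hpos n) K).integrable (ae_of_all _ fun ω ↦ ?_)
    calc _ ≤ Real.exp (c * _) ^ 2 := pow_le_pow_left₀ (expMart_pos _ _ _ _).le
          (expMart_le_exp _ _ _ _) 2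
      _ = _ := by rw [← Real.exp_nat_mul]; push_cast; ring_nf
  · simp_rw [hB.integral_expMart_gridIndex c (hpos _) K]
    exact tendsto_const_nhds

lemma IsRegularBrownian.integral_stoppedArea (hB : IsRegularBrownian B P)
    {c : ℝ} (hc : c ≠ 0) (K : ℝ≥0) : ∫ ω, stoppedArea B c K ω ∂P = 0 := by
  have hpos (n : ℕ) : 0 < 1 / ((n : ℝ≥0) + 1) := by positivity
  obtain ⟨C, hC⟩ := hB.exists_integral_areaMart_sq_le c K
  refine tendsto_nhds_unique (tendsto_integral_of_integral_sq_le
    (fun n ↦ (hB.hasFiniteMoments_areaMart_gridIndex c (hpos n) K).integrable.1)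
    (fun n ↦ ((hB.hasFiniteMoments_areaMart_gridIndex c (hpos n) K).pow 2).integrable)
    (fun n ↦ hC _ (hpos n) (one_div_nat_add_one_le_one n))
    (ae_of_all _ fun ω ↦ hB.tendsto_areaMart_gridIndex c K ω)) ?_
  simp_rw [hB.integral_areaMart_gridIndex hc (hpos _) K]
  exact tendsto_const_nhds

end ContinuousStopping

/-! ### Finiteness and Laplace transform of the hitting time. -/

section LaplaceTransforms

variable {Ω : Type*} [MeasurableSpace Ω] {P : Measure Ω} {B : ℝ≥0 → Ω → ℝ}

lemma apply_truncatedHittingTime_of_le {Ω : Type*} {B : ℝ≥0 → Ω → ℝ} {ω : Ω}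
    (hc : Continuous (B · ω)) {K : ℝ≥0} (h : levelHittingTime B 1 ω ≤ K) :
    B (truncatedHittingTime B 1 K ω) ω = 1 := by
  have := coe_truncatedHittingTime (X := B) (a := 1) (ω := ω) K
  rw [min_eq_left h] at this
  exact apply_eq_of_levelHittingTime_eq hc this.symm

lemma eventually_levelHittingTime_le {Ω : Type*} {B : ℝ≥0 → Ω → ℝ} {ω : Ω}
    (h : levelHittingTime B 1 ω < ⊤) :
    ∀ᶠ K : ℕ in atTop, levelHittingTime B 1 ω ≤ ((K : ℝ≥0) : WithTop ℝ≥0) := by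
  obtain ⟨t, ht⟩ := WithTop.ne_top_iff_exists.1 h.ne
  obtain ⟨N, hN⟩ := exists_nat_ge t
  filter_upwards [eventually_ge_atTop N] with K hK
  rw [← ht, WithTop.coe_le_coe]
  exact hN.trans (by exact_mod_cast hK)

/-- If the level is never hit, the path stays below `1`, so the martingale at time `K` is at most
`exp (c - c² K / 2)` and vanishes in the limit. Otherwise the sequence is eventually constant. -/
lemma IsRegularBrownian.tendsto_expMart_truncated (hB : IsRegularBrownian B P) {c : ℝ} (hc : 0 < c)
    (ω : Ω) :
    Tendsto (fun K : ℕ ↦ expMart B c (truncatedHittingTime B 1 K ω) ω) atTop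
      (𝓝 ({ω | levelHittingTime B 1 ω < ⊤}.indicator
        (fun ω ↦ Real.exp (c - c ^ 2 * levelHittingTimeReal B 1 ω / 2)) ω)) := by
  by_cases h : levelHittingTime B 1 ω < ⊤
  · rw [Set.indicator_of_mem (by exact h)]
    refine tendsto_const_nhds.congr' ?_
    filter_upwards [eventually_levelHittingTime_le h] with K hK
    rw [expMart, apply_truncatedHittingTime_of_le (hB.continuous ω) hK,
      truncatedHittingTime_of_le hK, mul_one]
  · rw [Set.indicator_of_notMem (by exact h)]
    have htop : levelHittingTime B 1 ω = ⊤ := not_lt_top_iff.1 h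
    have hlim : Tendsto (fun K : ℕ ↦ Real.exp (c - c ^ 2 * K / 2)) atTop (𝓝 0) := by
      refine Real.tendsto_exp_atBot.comp ?_
      have : Tendsto (fun K : ℕ ↦ c ^ 2 / 2 * (K : ℝ)) atTop atTop :=
        tendsto_natCast_atTop_atTop.const_mul_atTop (by positivity)
      refine (tendsto_atBot_add_const_left _ c (tendsto_neg_atTop_atBot.comp this)).congr fun K ↦ ?_
      simp only [Function.comp]
      ring
    refine squeeze_zero (fun K ↦ (expMart_pos B c _ ω).le) (fun K ↦ ?_) hlim
    have hK : ((K : ℝ≥0) : WithTop ℝ≥0) < levelHittingTime B 1 ω := htop ▸ WithTop.coe_lt_top _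
    have h1 := (coe_lt_levelHittingTime_iff (hB.continuous ω) (hB.zero ω) one_pos).1 hK K le_rfl
    rw [truncatedHittingTime_of_ge hK.le, expMart, Real.exp_le_exp]
    push_cast
    nlinarith

lemma IsRegularBrownian.expMart_truncated_le (hB : IsRegularBrownian B P) {c : ℝ} (hc : 0 ≤ c)
    (K : ℝ≥0) (ω : Ω) : expMart B c (truncatedHittingTime B 1 K ω) ω ≤ Real.exp c := by
  refine (expMart_le_exp _ _ _ _).trans (Real.exp_le_exp.2 ?_)
  have := apply_truncatedHittingTime_le (hB.continuous ω) (hB.zero ω) one_pos K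
  nlinarith

lemma IsRegularBrownian.measurable_truncatedHittingTime (hB : IsRegularBrownian B P) (K : ℝ≥0) :
    Measurable (truncatedHittingTime B 1 K) := by
  refine measurable_of_Ioi fun s ↦ ?_
  have : truncatedHittingTime B 1 K ⁻¹' Set.Ioi s =
      {ω | (s : WithTop ℝ≥0) < levelHittingTime B 1 ω} ∩ {_ω | s < K} := by
    ext ω
    exact lt_truncatedHittingTime_iff
  rw [this]
  exact (pastSigma_le hB.measurable s _ (measurableSet_coe_lt_levelHittingTime hB.continuous
    hB.zero one_pos s)).inter (MeasurableSet.const _)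

lemma IsRegularBrownian.measurableSet_levelHittingTime_lt_top (hB : IsRegularBrownian B P) :
    MeasurableSet {ω | levelHittingTime B 1 ω < ⊤} := by
  have : {ω | levelHittingTime B 1 ω < ⊤} =
      ⋃ n : ℕ, {ω | ((n : ℝ≥0) : WithTop ℝ≥0) < levelHittingTime B 1 ω}ᶜ := by
    ext ω
    simp only [Set.mem_ofPred_eq, Set.mem_iUnion, Set.mem_compl_iff, not_lt]
    refine ⟨fun h ↦ ?_, fun ⟨n, hn⟩ ↦ hn.trans_lt (WithTop.coe_lt_top _)⟩
    exact (eventually_levelHittingTime_le h).exists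
  rw [this]
  exact MeasurableSet.iUnion fun n ↦ (pastSigma_le hB.measurable _ _
    (measurableSet_coe_lt_levelHittingTime hB.continuous hB.zero one_pos _)).compl

variable [IsProbabilityMeasure P]

lemma IsRegularBrownian.integral_indicator_exp_levelHittingTime (hB : IsRegularBrownian B P)
    {c : ℝ} (hc : 0 < c) :
    ∫ ω, {ω | levelHittingTime B 1 ω < ⊤}.indicator
      (fun ω ↦ Real.exp (c - c ^ 2 * levelHittingTimeReal B 1 ω / 2)) ω ∂P = 1 := by
  have h := tendsto_integral_of_dominated_convergence (μ := P) (fun _ ↦ Real.exp c)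
    (fun K : ℕ ↦ hB.aestronglyMeasurable_expMart_truncated c K) (integrable_const _)
    (fun K ↦ ae_of_all _ fun ω ↦ ?_)
    (ae_of_all _ fun ω ↦ hB.tendsto_expMart_truncated hc ω)
  · simp_rw [hB.integral_expMart_truncated c] at h
    exact tendsto_nhds_unique h tendsto_const_nhds
  · rw [Real.norm_of_nonneg (expMart_pos _ _ _ _).le]
    exact hB.expMart_truncated_le hc.le K ω

/-- The stopped identity gives `1 ≤ exp c * P(T < ∞)` for every `c > 0`; let `c` tend to `0`. -/
lemma IsRegularBrownian.ae_levelHittingTime_lt_top (hB : IsRegularBrownian B P) :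
    ∀ᵐ ω ∂P, levelHittingTime B 1 ω < ⊤ := by
  have hm := hB.measurableSet_levelHittingTime_lt_top
  have hle {c : ℝ} (hc : 0 < c) :
      Real.exp (-c) ≤ P.real {ω | levelHittingTime B 1 ω < ⊤} := by
    have h := hB.integral_indicator_exp_levelHittingTime hc
    have h2 : (1 : ℝ) ≤ ∫ ω, {ω | levelHittingTime B 1 ω < ⊤}.indicator
        (fun _ ↦ Real.exp c) ω ∂P := by
      refine h.ge.trans ?_
      refine integral_mono_of_nonneg (ae_of_all _ fun ω ↦ Set.indicator_nonneg
        (fun _ _ ↦ (Real.exp_pos _).le) ω) ((integrable_const _).indicator hm)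
        (ae_of_all _ fun ω ↦ Set.indicator_le_indicator ?_)
      have : 0 ≤ c ^ 2 * levelHittingTimeReal B 1 ω / 2 :=
        div_nonneg (mul_nonneg (sq_nonneg c) NNReal.zero_le_coe) zero_le_two
      exact Real.exp_le_exp.2 (by linarith)
    rw [integral_indicator_const _ hm, smul_eq_mul] at h2
    rw [Real.exp_neg, inv_le_iff_one_le_mul₀ (Real.exp_pos c)]
    exact h2
  have hlim : Tendsto (fun c : ℝ ↦ Real.exp (-c)) (𝓝[>] 0) (𝓝 1) := by
    have : Continuous fun c : ℝ ↦ Real.exp (-c) := by fun_prop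
    simpa using (this.tendsto 0).mono_left nhdsWithin_le_nhds
  have h1 : 1 ≤ P.real {ω | levelHittingTime B 1 ω < ⊤} :=
    le_of_tendsto hlim (eventually_mem_nhdsWithin.mono fun c hc ↦ hle hc)
  have h2 : P {ω | levelHittingTime B 1 ω < ⊤} = 1 := by
    rw [measureReal_def] at h1
    refine le_antisymm prob_le_one ?_
    rwa [← ENNReal.ofReal_one, ENNReal.ofReal_le_iff_le_toReal (measure_ne_top _ _)]
  exact (prob_compl_eq_zero_iff hm).2 h2

lemma IsRegularBrownian.aemeasurable_levelHittingTimeReal (hB : IsRegularBrownian B P) :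
    AEMeasurable (levelHittingTimeReal B 1) P := by
  refine aemeasurable_of_tendsto_metrizable_ae atTop
    (f := fun (K : ℕ) ω ↦ (truncatedHittingTime B 1 K ω : ℝ))
    (fun K ↦ (hB.measurable_truncatedHittingTime K).coe_nnreal_real.aemeasurable) ?_
  filter_upwards [hB.ae_levelHittingTime_lt_top] with ω hω
  refine tendsto_const_nhds.congr' ?_
  filter_upwards [eventually_levelHittingTime_le hω] with K hK
  exact (truncatedHittingTime_of_le hK).symm

/-- The Laplace transform of the hitting time of `1`. -/
lemma IsRegularBrownian.integral_exp_neg_levelHittingTimeReal (hB : IsRegularBrownian B P)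
    {c : ℝ} (hc : 0 < c) :
    ∫ ω, Real.exp (-(c ^ 2 / 2) * levelHittingTimeReal B 1 ω) ∂P = Real.exp (-c) := by
  have h := hB.integral_indicator_exp_levelHittingTime hc
  have h2 : ∫ ω, {ω | levelHittingTime B 1 ω < ⊤}.indicator
      (fun ω ↦ Real.exp (c - c ^ 2 * levelHittingTimeReal B 1 ω / 2)) ω ∂P =
      ∫ ω, Real.exp c * Real.exp (-(c ^ 2 / 2) * levelHittingTimeReal B 1 ω) ∂P := by
    refine integral_congr_ae ?_
    filter_upwards [hB.ae_levelHittingTime_lt_top] with ω hω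
    rw [Set.indicator_of_mem (by exact hω), ← Real.exp_add]
    ring_nf
  rw [h2, integral_const_mul] at h
  rw [Real.exp_neg]
  exact eq_inv_of_mul_eq_one_right h

end LaplaceTransforms

/-! ### Weighted integrals of the path. -/

section PathIntegrals

variable {Ω : Type*} [MeasurableSpace Ω] {P : Measure Ω} {B : ℝ≥0 → Ω → ℝ}

lemma levelHittingTimeReal_nonneg {Ω : Type*} (X : ℝ≥0 → Ω → ℝ) (a : ℝ) (ω : Ω) :
    0 ≤ levelHittingTimeReal X a ω := NNReal.zero_le_coe

lemma IsRegularBrownian.continuous_toNNReal (hB : IsRegularBrownian B P) (ω : Ω) :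
    Continuous fun s : ℝ ↦ B s.toNNReal ω :=
  (hB.continuous ω).comp continuous_real_toNNReal

lemma IsRegularBrownian.measurable_uncurry (hB : IsRegularBrownian B P) :
    Measurable fun p : Ω × ℝ ↦ B p.2.toNNReal p.1 := by
  have h : Measurable (Function.uncurry fun (s : ℝ) ω ↦ B s.toNNReal ω) :=
    measurable_uncurry_of_continuous_of_measurable hB.continuous_toNNReal
      fun s ↦ hB.measurable _
  exact h.comp measurable_swap

/-- Brownian scaling: `B t` has the law of `√t` times a standard Gaussian. -/
lemma IsRegularBrownian.integral_pow_two_mul (hB : IsRegularBrownian B P) (n : ℕ) (t : ℝ≥0) :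
    ∫ ω, B t ω ^ (2 * n) ∂P = t ^ n * ∫ x, x ^ (2 * n) ∂gaussianReal 0 1 := by
  have h := (hB.hasLaw_eval t).integral_comp (f := fun x : ℝ ↦ x ^ (2 * n)) (by fun_prop)
  have hmap := gaussianReal_map_const_mul (μ := 0) (v := 1) √t
  have hv : NNReal.mk (√(t : ℝ) ^ 2) (sq_nonneg _) * 1 = t := by
    rw [mul_one]
    exact NNReal.eq (Real.sq_sqrt t.coe_nonneg)
  rw [mul_zero, hv] at hmap
  calc _ = ∫ x, x ^ (2 * n) ∂gaussianReal 0 t := h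
    _ = ∫ x, (√t * x) ^ (2 * n) ∂gaussianReal 0 1 := by
        rw [← hmap, integral_map (by fun_prop) (by fun_prop)]
    _ = _ := by
        simp_rw [mul_pow, pow_mul √(t : ℝ), Real.sq_sqrt t.coe_nonneg]
        rw [integral_const_mul]

/-- Integrability of a weighted path, from bounds of the moments. -/
lemma IsRegularBrownian.integrable_prod_weight_mul (hB : IsRegularBrownian B P) [SFinite P]
    {φ : ℝ → ℝ} (hφ : Measurable φ) (hφ0 : ∀ x, 0 ≤ φ x)
    (hφi : ∀ t, Integrable (fun ω ↦ φ (B t ω)) P) {w g : ℝ → ℝ}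
    (hw : Measurable w) (hw0 : ∀ s, 0 < s → 0 ≤ w s)
    (hg : ∀ s : ℝ≥0, ∫ ω, φ (B s ω) ∂P ≤ g s)
    (hint : IntegrableOn (fun s ↦ w s * g s) (Set.Ioi 0)) :
    Integrable (fun p : Ω × ℝ ↦ w p.2 * φ (B p.2.toNNReal p.1))
      (P.prod (volume.restrict (Set.Ioi 0))) := by
  have hmeas : Measurable fun p : Ω × ℝ ↦ w p.2 * φ (B p.2.toNNReal p.1) :=
    (hw.comp measurable_snd).mul (hφ.comp hB.measurable_uncurry)
  rw [integrable_prod_iff' hmeas.aestronglyMeasurable]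
  refine ⟨ae_of_all _ fun s ↦ (hφi s.toNNReal).const_mul (w s), ?_⟩
  refine Integrable.mono' hint hmeas.stronglyMeasurable.norm.integral_prod_left'.aestronglyMeasurable
    ((ae_restrict_mem measurableSet_Ioi).mono fun s hs ↦ ?_)
  have hs' : 0 < s := hs
  rw [Real.norm_of_nonneg (integral_nonneg fun _ ↦ norm_nonneg _)]
  simp_rw [norm_mul, Real.norm_of_nonneg (hw0 s hs'), Real.norm_of_nonneg (hφ0 _)]
  rw [integral_const_mul]
  refine mul_le_mul_of_nonneg_left ?_ (hw0 s hs')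
  simpa [hs'.le] using hg s.toNNReal

lemma IsRegularBrownian.stronglyMeasurable_integral (hB : IsRegularBrownian B P) {τ : Ω → ℝ}
    (hτ : Measurable τ) (hτ0 : ∀ ω, 0 ≤ τ ω) :
    StronglyMeasurable fun ω ↦ ∫ s in (0 : ℝ)..τ ω, B s.toNNReal ω := by
  have heq ω : ∫ s in (0 : ℝ)..τ ω, B s.toNNReal ω =
      ∫ s, {p : Ω × ℝ | 0 < p.2 ∧ p.2 ≤ τ p.1}.indicator (fun p ↦ B p.2.toNNReal p.1) (ω, s) := by
    rw [intervalIntegral.integral_of_le (hτ0 ω), ← integral_indicator measurableSet_Ioc]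
    rfl
  simp_rw [heq]
  have hset : MeasurableSet {p : Ω × ℝ | 0 < p.2 ∧ p.2 ≤ τ p.1} :=
    (measurableSet_lt measurable_const measurable_snd).inter
      (measurableSet_le measurable_snd (hτ.comp measurable_fst))
  exact (hB.measurable_uncurry.indicator hset).stronglyMeasurable.integral_prod_right'

lemma IsRegularBrownian.aestronglyMeasurable_integral_levelHittingTimeReal
    (hB : IsRegularBrownian B P) [IsProbabilityMeasure P] :
    AEStronglyMeasurable
      (fun ω ↦ ∫ s in (0 : ℝ)..levelHittingTimeReal B 1 ω, B s.toNNReal ω) P := by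
  refine aestronglyMeasurable_of_tendsto_ae atTop
    (f := fun (K : ℕ) ω ↦ ∫ s in (0 : ℝ)..truncatedHittingTime B 1 K ω, B s.toNNReal ω)
    (fun K ↦ (hB.stronglyMeasurable_integral
      (hB.measurable_truncatedHittingTime K).coe_nnreal_real
      fun _ ↦ NNReal.zero_le_coe).aestronglyMeasurable) ?_
  filter_upwards [hB.ae_levelHittingTime_lt_top] with ω hω
  refine tendsto_const_nhds.congr' ?_
  filter_upwards [eventually_levelHittingTime_le hω] with K hK
  rw [truncatedHittingTime_of_le hK]

lemma IsRegularBrownian.integrable_prod_exp_mul_abs (hB : IsRegularBrownian B P)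
    [IsProbabilityMeasure P] {b : ℝ} (hb : 0 < b) :
    Integrable (fun p : Ω × ℝ ↦ Real.exp (-b * p.2) * |B p.2.toNNReal p.1|)
      (P.prod (volume.restrict (Set.Ioi 0))) := by
  set C := ∫ x, x ^ (2 * 1) ∂gaussianReal 0 1
  refine hB.integrable_prod_weight_mul (φ := fun x ↦ |x|) (w := fun s ↦ Real.exp (-b * s))
    (g := fun s ↦ 1 + s * C) (by fun_prop) abs_nonneg
    (fun t ↦ (hB.hasFiniteMoments t).integrable.abs) (by fun_prop)
    (fun _ _ ↦ (Real.exp_pos _).le) (fun s ↦ ?_) ?_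
  · have h2 : Integrable (fun ω ↦ B s ω ^ (2 * 1)) P := ((hB.hasFiniteMoments s).pow _).integrable
    calc _ ≤ ∫ ω, 1 + B s ω ^ (2 * 1) ∂P := by
          refine integral_mono (hB.hasFiniteMoments s).integrable.abs
            ((integrable_const _).add h2) fun ω ↦ ?_
          simp only [mul_one]
          nlinarith [sq_abs (B s ω), sq_nonneg (|B s ω| - 1), abs_nonneg (B s ω)]
      _ = _ := by
          rw [integral_add (integrable_const _) h2, hB.integral_pow_two_mul 1 s]
          simp [C]
  · have h0 : IntegrableOn (fun s : ℝ ↦ Real.exp (-b * s)) (Set.Ioi 0) :=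
      integrableOn_exp_mul_Ioi (by linarith) 0
    have h1 := integrableOn_rpow_mul_exp_neg_mul_rpow (s := 1) (p := 1) (by norm_num) one_pos hb
    simp only [Real.rpow_one] at h1
    refine (h0.add (h1.mul_const C)).congr (ae_of_all _ fun s ↦ ?_)
    simp only [Pi.add_apply]
    ring

/-- The discounted integral of the absolute value of the path. -/
noncomputable def discountedAbs (B : ℝ≥0 → Ω → ℝ) (b : ℝ) (ω : Ω) : ℝ :=
  ∫ s in Set.Ioi (0 : ℝ), Real.exp (-b * s) * |B s.toNNReal ω|

lemma IsRegularBrownian.integrable_discountedAbs (hB : IsRegularBrownian B P)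
    [IsProbabilityMeasure P] {b : ℝ} (hb : 0 < b) : Integrable (discountedAbs B b) P :=
  (hB.integrable_prod_exp_mul_abs hb).integral_prod_left

/-- On `[0, t]` the discount `exp (-b t)` is at most `exp (-b s)`. The bound holds for all `t` at
once, so it applies at random times. -/
lemma IsRegularBrownian.ae_exp_mul_abs_integral_le (hB : IsRegularBrownian B P)
    [IsProbabilityMeasure P] {b : ℝ} (hb : 0 < b) :
    ∀ᵐ ω ∂P, ∀ t : ℝ, 0 ≤ t →
      Real.exp (-b * t) * |∫ s in (0 : ℝ)..t, B s.toNNReal ω| ≤ discountedAbs B b ω := by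
  filter_upwards [(hB.integrable_prod_exp_mul_abs hb).prod_right_ae] with ω hω t ht
  have hcont := hB.continuous_toNNReal ω
  have hcont2 : Continuous fun s : ℝ ↦ Real.exp (-b * s) * |B s.toNNReal ω| :=
    Continuous.mul (by fun_prop) hcont.abs
  calc _ ≤ Real.exp (-b * t) * ∫ s in (0 : ℝ)..t, |B s.toNNReal ω| := by
        gcongr
        exact intervalIntegral.abs_integral_le_integral_abs ht
    _ = ∫ s in (0 : ℝ)..t, Real.exp (-b * t) * |B s.toNNReal ω| := by
        rw [intervalIntegral.integral_const_mul]
    _ ≤ ∫ s in (0 : ℝ)..t, Real.exp (-b * s) * |B s.toNNReal ω| := by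
        refine intervalIntegral.integral_mono_on ht
          ((hcont.abs.const_mul _).intervalIntegrable _ _) (hcont2.intervalIntegrable _ _)
          fun s hs ↦ ?_
        gcongr ?_ * _
        rw [Real.exp_le_exp]
        nlinarith [hs.2]
    _ ≤ _ := by
        rw [intervalIntegral.integral_of_le ht]
        exact setIntegral_mono_set hω (ae_of_all _ fun s ↦ by positivity)
          Set.Ioc_subset_Ioi_self.eventuallyLE

end PathIntegrals

/-! ### The discounted path integral up to the hitting time. -/

section AreaLaplace

variable {Ω : Type*} [MeasurableSpace Ω] {P : Measure Ω} {B : ℝ≥0 → Ω → ℝ}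

/-- In the variable `y = c x` the quadratic is `(y - y²) / (2c³)`, dominated by `exp y + exp (-y)`.
After multiplication by `exp y`, only the upper bound `y ≤ c` is needed. -/
lemma exp_mul_abs_quadratic_le {c x : ℝ} (hc : 0 < c) (hx : x ≤ 1) :
    Real.exp (c * x) * |-(1 / (2 * c)) * x ^ 2 + 1 / (2 * c ^ 2) * x| ≤
      (Real.exp (2 * c) + 1) / c ^ 3 := by
  have hprod : Real.exp (c * x) * (Real.exp (c * x) + Real.exp (-(c * x))) ≤
      Real.exp (2 * c) + 1 := by
    rw [mul_add, ← Real.exp_add, ← Real.exp_add, add_neg_cancel, Real.exp_zero]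
    gcongr
    nlinarith
  have h1 := sq_le_exp_add_exp_neg (c * x)
  have h2 := abs_le_exp_add_exp_neg (c * x)
  have heq : -(1 / (2 * c)) * x ^ 2 + 1 / (2 * c ^ 2) * x =
      (-(c * x) ^ 2 + c * x) / (2 * c ^ 3) := by
    field_simp
  rw [heq, abs_div, abs_of_pos (show 0 < 2 * c ^ 3 by positivity)]
  have h3 : |-(c * x) ^ 2 + c * x| ≤ 2 * (Real.exp (c * x) + Real.exp (-(c * x))) := by
    refine (abs_add_le _ _).trans ?_
    rw [abs_neg, abs_of_nonneg (sq_nonneg (c * x))]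
    linarith
  rw [mul_div_assoc', div_le_div_iff₀ (by positivity) (by positivity)]
  have h4 := mul_le_mul_of_nonneg_left h3 (Real.exp_pos (c * x)).le
  have h5 : 0 < c ^ 3 := by positivity
  nlinarith [mul_le_mul_of_nonneg_right (h4.trans_eq (mul_left_comm _ _ _)) h5.le,
    mul_le_mul_of_nonneg_right hprod h5.le]

variable [IsProbabilityMeasure P]

/-- An integrable bound free of `K`, for dominated convergence: the factor `exp (-c² t / 2)` of the
martingale controls the path integral, and `B ≤ 1` before the hitting time controls the rest. -/
lemma IsRegularBrownian.ae_abs_stoppedArea_le (hB : IsRegularBrownian B P) {c : ℝ} (hc : 0 < c) :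
    ∀ᵐ ω ∂P, ∀ K : ℝ≥0, |stoppedArea B c K ω| ≤
      Real.exp c * discountedAbs B (c ^ 2 / 2) ω + (Real.exp (2 * c) + 1) / c ^ 3 := by
  filter_upwards [hB.ae_exp_mul_abs_integral_le (b := c ^ 2 / 2) (by positivity)] with ω hω K
  have hx := apply_truncatedHittingTime_le (hB.continuous ω) (hB.zero ω) one_pos K
  set τ := truncatedHittingTime B 1 K ω
  rw [stoppedArea, abs_mul, abs_of_pos (expMart_pos _ _ _ _)]
  refine (mul_le_mul_of_nonneg_left (abs_add_le _ _) (expMart_pos _ _ _ _).le).trans ?_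
  rw [mul_add]
  refine add_le_add ?_ ?_
  · have : expMart B c τ ω = Real.exp (c * B τ ω) * Real.exp (-(c ^ 2 / 2) * τ) := by
      rw [expMart, ← Real.exp_add]
      ring_nf
    rw [this, mul_assoc]
    have h := hω τ τ.coe_nonneg
    gcongr
    nlinarith
  · refine le_trans ?_ (exp_mul_abs_quadratic_le hc hx)
    gcongr
    exact expMart_le_exp B c τ ω

lemma IsRegularBrownian.integrable_exp_mul_pathIntegral (hB : IsRegularBrownian B P) {b : ℝ}
    (hb : 0 < b) :
    Integrable (fun ω ↦ Real.exp (-b * levelHittingTimeReal B 1 ω) *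
      ∫ s in (0 : ℝ)..levelHittingTimeReal B 1 ω, B s.toNNReal ω) P := by
  refine Integrable.mono' (hB.integrable_discountedAbs hb)
    ((hB.aemeasurable_levelHittingTimeReal.const_mul (-b)).exp.aestronglyMeasurable.mul
      hB.aestronglyMeasurable_integral_levelHittingTimeReal) ?_
  filter_upwards [hB.ae_exp_mul_abs_integral_le hb] with ω hω
  rw [norm_mul, Real.norm_of_nonneg (Real.exp_pos _).le]
  exact hω _ (levelHittingTimeReal_nonneg _ _ _)

/-- The integral is already known to be nonzero, which rules out the default value of a
non-integrable function. -/
lemma IsRegularBrownian.integrable_exp_neg_levelHittingTimeReal (hB : IsRegularBrownian B P)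
    {c : ℝ} (hc : 0 < c) :
    Integrable (fun ω ↦ Real.exp (-(c ^ 2 / 2) * levelHittingTimeReal B 1 ω)) P := by
  by_contra hcon
  have := hB.integral_exp_neg_levelHittingTimeReal hc
  rw [integral_undef hcon] at this
  exact (Real.exp_pos _).ne this

/-- The expected path integral up to the hitting time of `1`, discounted at this time. -/
lemma IsRegularBrownian.integral_exp_mul_pathIntegral (hB : IsRegularBrownian B P) {c : ℝ}
    (hc : 0 < c) :
    ∫ ω, Real.exp (-(c ^ 2 / 2) * levelHittingTimeReal B 1 ω) *
      (∫ s in (0 : ℝ)..levelHittingTimeReal B 1 ω, B s.toNNReal ω) ∂P =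
      Real.exp (-c) * (c - 1) / (2 * c ^ 2) := by
  have hb : 0 < c ^ 2 / 2 := by positivity
  have hlim := tendsto_integral_of_dominated_convergence (μ := P)
    (F := fun K : ℕ ↦ stoppedArea B c K)
    (f := fun ω ↦ Real.exp c * (Real.exp (-(c ^ 2 / 2) * levelHittingTimeReal B 1 ω) *
      (∫ s in (0 : ℝ)..levelHittingTimeReal B 1 ω, B s.toNNReal ω) +
      Real.exp (-(c ^ 2 / 2) * levelHittingTimeReal B 1 ω) *
        (-(1 / (2 * c)) + 1 / (2 * c ^ 2))))
    (fun ω ↦ Real.exp c * discountedAbs B (c ^ 2 / 2) ω + (Real.exp (2 * c) + 1) / c ^ 3)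
    (fun K ↦ hB.aestronglyMeasurable_stoppedArea c K)
    (((hB.integrable_discountedAbs hb).const_mul _).add (integrable_const _))
    (fun K ↦ (hB.ae_abs_stoppedArea_le hc).mono fun ω hω ↦ hω K) ?_
  · simp_rw [hB.integral_stoppedArea hc.ne'] at hlim
    have h0 := tendsto_nhds_unique hlim tendsto_const_nhds
    have hexp := hB.integrable_exp_neg_levelHittingTimeReal hc
    rw [integral_const_mul, integral_add (hB.integrable_exp_mul_pathIntegral hb)
      (hexp.mul_const _), integral_mul_const, hB.integral_exp_neg_levelHittingTimeReal hc] at h0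
    have h1 := (mul_eq_zero.1 h0).resolve_left (Real.exp_pos c).ne'
    rw [eq_neg_of_add_eq_zero_left h1]
    field_simp
    ring
  · filter_upwards [hB.ae_levelHittingTime_lt_top] with ω hω
    refine tendsto_const_nhds.congr' ?_
    filter_upwards [eventually_levelHittingTime_le hω] with K hK
    rw [stoppedArea, expMart, apply_truncatedHittingTime_of_le (hB.continuous ω) hK,
      truncatedHittingTime_of_le hK, one_pow, mul_one, mul_one, mul_one, ← mul_add, ← mul_assoc,
      ← Real.exp_add]
    ring_nf

end AreaLaplace

/-! ### Negative moments and the moment of order `1/4` of the hitting time. -/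

section HittingTimeMoments

variable {Ω : Type*} [MeasurableSpace Ω] {P : Measure Ω} {B : ℝ≥0 → Ω → ℝ}

lemma integrable_prod_Ioi_of_integral_eq [SFinite P] {F : Ω × ℝ → ℝ} {m : ℝ → ℝ}
    (hF : AEStronglyMeasurable F (P.prod (volume.restrict (Set.Ioi 0))))
    (h0 : ∀ ω, ∀ θ > 0, 0 ≤ F (ω, θ)) (hi : ∀ θ > 0, Integrable (fun ω ↦ F (ω, θ)) P)
    (hm : ∀ θ > 0, ∫ ω, F (ω, θ) ∂P = m θ) (hint : IntegrableOn m (Set.Ioi 0)) :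
    Integrable F (P.prod (volume.restrict (Set.Ioi 0))) := by
  rw [integrable_prod_iff' hF]
  refine ⟨(ae_restrict_mem measurableSet_Ioi).mono fun θ hθ ↦ hi θ hθ,
    IntegrableOn.congr_fun hint (fun θ hθ ↦ ?_) measurableSet_Ioi⟩
  rw [← hm θ hθ]
  exact integral_congr_ae (ae_of_all _ fun ω ↦ (Real.norm_of_nonneg (h0 ω θ hθ)).symm)

/-- Turns Laplace transforms at `θ² / 2` into powers of `t`; `q = 2` produces the normalisation `t ^
(-3/2)`. -/
lemma integral_rpow_mul_exp_neg_half_sq_mul {q t : ℝ} (hq : -1 < q) (ht : 0 < t) :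
    ∫ θ in Set.Ioi (0 : ℝ), θ ^ q * Real.exp (-(θ ^ 2 / 2) * t) =
      t ^ (-(q + 1) / 2) *
        ((1 / 2) ^ (-(q + 1) / 2) * (1 / 2) * Real.Gamma ((q + 1) / 2)) := by
  have h := integral_rpow_mul_exp_neg_mul_rpow (p := 2) (q := q) (b := t * (1 / 2)) two_pos hq
    (by positivity)
  rw [Real.mul_rpow ht.le (by norm_num)] at h
  rw [← mul_assoc, ← mul_assoc, ← h]
  refine setIntegral_congr_fun measurableSet_Ioi fun θ _ ↦ ?_
  simp only [Real.rpow_two]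
  ring_nf

lemma integrableOn_rpow_mul_exp_neg_half_sq_mul {q t : ℝ} (hq : -1 < q) (ht : 0 < t) :
    IntegrableOn (fun θ : ℝ ↦ θ ^ q * Real.exp (-(θ ^ 2 / 2) * t)) (Set.Ioi 0) := by
  refine (integrableOn_rpow_mul_exp_neg_mul_rpow (p := 2) (s := q) (b := t * (1 / 2)) hq two_pos
    (by positivity)).congr_fun (fun θ _ ↦ ?_) measurableSet_Ioi
  simp only [Real.rpow_two]
  ring_nf

lemma rpow_quarter_mul_le_integral {t : ℝ} (ht : 0 < t)
    (hint : IntegrableOn (fun θ : ℝ ↦ (1 - Real.exp (-(θ ^ 2 / 2) * t)) * θ ^ (-(3 / 2) : ℝ))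
      (Set.Ioi 0)) :
    (1 - Real.exp (-(1 / 2))) * 2 ^ (-(3 / 2) : ℝ) * t ^ (1 / 4 : ℝ) ≤
      ∫ θ in Set.Ioi (0 : ℝ), (1 - Real.exp (-(θ ^ 2 / 2) * t)) * θ ^ (-(3 / 2) : ℝ) := by
  -- The natural scale of the integrand: on `(r, 2r]` the exponent `θ² t / 2` is at least `1/2`, and
  -- this window alone contributes a multiple of `t ^ (1/4)`.
  set r := t ^ (-(1 / 2) : ℝ)
  have hr : 0 < r := by positivity
  have hr2 : r ^ 2 * t = 1 := by
    rw [← Real.rpow_natCast, ← Real.rpow_mul ht.le]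
    norm_num
    rw [Real.rpow_neg_one, inv_mul_cancel₀ ht.ne']
  have hsub : Set.Ioc r (2 * r) ⊆ Set.Ioi 0 := fun θ hθ ↦ hr.trans hθ.1
  have h0 : ∀ θ ∈ Set.Ioi (0 : ℝ), 0 ≤ (1 - Real.exp (-(θ ^ 2 / 2) * t)) * θ ^ (-(3 / 2) : ℝ) :=
    fun θ hθ ↦ by
      have hθ' : 0 < θ := hθ
      have : Real.exp (-(θ ^ 2 / 2) * t) ≤ 1 := Real.exp_le_one_iff.2 (by
        have : 0 ≤ θ ^ 2 / 2 * t := by positivity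
        linarith)
      exact mul_nonneg (by linarith) (by positivity)
  have hlow := setIntegral_ge_of_const_le_real (μ := volume) (s := Set.Ioc r (2 * r))
    (f := fun θ : ℝ ↦ (1 - Real.exp (-(θ ^ 2 / 2) * t)) * θ ^ (-(3 / 2) : ℝ))
    (c := (1 - Real.exp (-(1 / 2))) * (2 * r) ^ (-(3 / 2) : ℝ)) measurableSet_Ioc (by simp)
    (fun θ hθ ↦ ?_) (hint.mono_set hsub)
  · refine le_trans (le_of_eq ?_) (hlow.trans (setIntegral_mono_set hint
      ((ae_restrict_mem measurableSet_Ioi).mono h0) hsub.eventuallyLE))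
    rw [measureReal_def, Real.volume_Ioc, ENNReal.toReal_ofReal (by linarith),
      Real.mul_rpow zero_le_two hr.le]
    have hpow : t ^ (1 / 4 : ℝ) = r ^ (-(3 / 2) : ℝ) * r := by
      rw [← Real.rpow_add_one hr.ne', ← Real.rpow_mul ht.le]
      norm_num
    rw [hpow]
    ring
  · have hθ0 : 0 < θ := hr.trans hθ.1
    have hexp : Real.exp (-(θ ^ 2 / 2) * t) ≤ Real.exp (-(1 / 2)) := by
      rw [Real.exp_le_exp]
      have : r ^ 2 * t ≤ θ ^ 2 * t := by
        gcongr
        exact hθ.1.le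
      linarith
    have h1 : Real.exp (-(1 / 2) : ℝ) ≤ 1 := Real.exp_le_one_iff.2 (by norm_num)
    have hpow : (2 * r) ^ (-(3 / 2) : ℝ) ≤ θ ^ (-(3 / 2) : ℝ) :=
      Real.rpow_le_rpow_of_nonpos hθ0 hθ.2 (by norm_num)
    exact mul_le_mul (by linarith) hpow (by positivity) (by linarith)

/-- Near `0` use `1 - exp (-θ) ≤ θ`, near infinity `1 - exp (-θ) ≤ 1`. -/
lemma integrableOn_one_sub_exp_neg_mul_rpow :
    IntegrableOn (fun θ : ℝ ↦ (1 - Real.exp (-θ)) * θ ^ (-(3 / 2) : ℝ)) (Set.Ioi 0) := by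
  have hmeas : Measurable fun θ : ℝ ↦ (1 - Real.exp (-θ)) * θ ^ (-(3 / 2) : ℝ) := by fun_prop
  have hnorm {θ : ℝ} (hθ : 0 < θ) : ‖(1 - Real.exp (-θ)) * θ ^ (-(3 / 2) : ℝ)‖ =
      (1 - Real.exp (-θ)) * θ ^ (-(3 / 2) : ℝ) := by
    have : Real.exp (-θ) ≤ 1 := Real.exp_le_one_iff.2 (by linarith)
    exact Real.norm_of_nonneg (mul_nonneg (by linarith) (by positivity))
  rw [← Set.Ioc_union_Ioi_eq_Ioi zero_le_one]
  refine IntegrableOn.union ?_ ?_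
  · have h : IntegrableOn (fun θ : ℝ ↦ θ ^ (-(1 / 2) : ℝ)) (Set.Ioc 0 1) :=
      (intervalIntegrable_iff_integrableOn_Ioc_of_le zero_le_one).1
        (intervalIntegral.intervalIntegrable_rpow' (by norm_num))
    refine Integrable.mono' h hmeas.aestronglyMeasurable
      ((ae_restrict_mem measurableSet_Ioc).mono fun θ hθ ↦ ?_)
    have hpow : θ ^ (-(1 / 2) : ℝ) = θ * θ ^ (-(3 / 2) : ℝ) := by
      rw [mul_comm, ← Real.rpow_add_one hθ.1.ne']
      norm_num
    rw [hnorm hθ.1, hpow]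
    have := Real.add_one_le_exp (-θ)
    have h0 : 0 ≤ θ ^ (-(3 / 2) : ℝ) := Real.rpow_nonneg hθ.1.le _
    gcongr
    linarith
  · refine Integrable.mono' (integrableOn_Ioi_rpow_of_lt (a := -(3 / 2)) (by norm_num) one_pos)
      hmeas.aestronglyMeasurable ((ae_restrict_mem measurableSet_Ioi).mono fun θ hθ ↦ ?_)
    have hθ0 : 0 < θ := one_pos.trans hθ
    rw [hnorm hθ0]
    refine mul_le_of_le_one_left (by positivity) ?_
    linarith [Real.exp_pos (-θ)]

lemma IsRegularBrownian.levelHittingTime_pos (hB : IsRegularBrownian B P) (ω : Ω) :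
    0 < levelHittingTime B 1 ω := by
  have := (coe_lt_levelHittingTime_iff (s := 0) (hB.continuous ω) (hB.zero ω) one_pos).2
    fun u hu ↦ by rw [le_zero_iff.1 hu, hB.zero]; exact one_pos
  simpa using this

variable [IsProbabilityMeasure P]

lemma IsRegularBrownian.ae_levelHittingTimeReal_pos (hB : IsRegularBrownian B P) :
    ∀ᵐ ω ∂P, 0 < levelHittingTimeReal B 1 ω := by
  filter_upwards [hB.ae_levelHittingTime_lt_top] with ω hω
  obtain ⟨t, ht⟩ := WithTop.ne_top_iff_exists.1 hω.ne
  have h := hB.levelHittingTime_pos ω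
  rw [levelHittingTimeReal, ← ht, WithTop.untopD_coe]
  rw [← ht] at h
  exact_mod_cast h

lemma IsRegularBrownian.aemeasurable_exp_prod (hB : IsRegularBrownian B P) :
    AEMeasurable (fun p : Ω × ℝ ↦ Real.exp (-(p.2 ^ 2 / 2) * levelHittingTimeReal B 1 p.1))
      (P.prod (volume.restrict (Set.Ioi 0))) := by
  have hT : AEMeasurable (fun p : Ω × ℝ ↦ levelHittingTimeReal B 1 p.1)
    (P.prod (volume.restrict (Set.Ioi 0))) := hB.aemeasurable_levelHittingTimeReal.comp_fst
  fun_prop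

/-- The negative moments of the hitting time are finite. -/
lemma IsRegularBrownian.integrable_levelHittingTimeReal_rpow_neg (hB : IsRegularBrownian B P)
    {q : ℝ} (hq : -1 < q) :
    Integrable (fun ω ↦ levelHittingTimeReal B 1 ω ^ (-(q + 1) / 2)) P := by
  have hF := integrable_prod_Ioi_of_integral_eq (P := P)
    (F := fun p ↦ p.2 ^ q * Real.exp (-(p.2 ^ 2 / 2) * levelHittingTimeReal B 1 p.1))
    (m := fun θ ↦ Real.exp (-θ) * θ ^ ((q + 1) - 1))
    ((measurable_snd.pow_const q).aemeasurable.mul hB.aemeasurable_exp_prod).aestronglyMeasurable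
    (fun ω θ hθ ↦ by have : 0 < θ := hθ
                     positivity)
    (fun θ hθ ↦ (hB.integrable_exp_neg_levelHittingTimeReal hθ).const_mul (θ ^ q))
    (fun θ hθ ↦ by
      simp only
      rw [integral_const_mul, hB.integral_exp_neg_levelHittingTimeReal hθ, mul_comm,
        add_sub_cancel_right])
    (Real.GammaIntegral_convergent (by linarith))
  have hconst : (1 / 2 : ℝ) ^ (-(q + 1) / 2) * (1 / 2) * Real.Gamma ((q + 1) / 2) ≠ 0 := by
    have := Real.Gamma_pos_of_pos (s := (q + 1) / 2) (by linarith)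
    positivity
  refine ((hF.integral_prod_left).mul_const
    ((1 / 2 : ℝ) ^ (-(q + 1) / 2) * (1 / 2) * Real.Gamma ((q + 1) / 2))⁻¹).congr ?_
  filter_upwards [hB.ae_levelHittingTimeReal_pos] with ω hω
  rw [integral_rpow_mul_exp_neg_half_sq_mul hq hω, mul_assoc, mul_inv_cancel₀ hconst, mul_one]

/-- Integrate `E[1 - exp (-θ² T / 2)] = 1 - exp (-θ)` against `θ ^ (-3/2)`; the inner integral over
`θ` dominates a multiple of `T ^ (1/4)`. -/
lemma IsRegularBrownian.integrable_levelHittingTimeReal_rpow_quarter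
    (hB : IsRegularBrownian B P) :
    Integrable (fun ω ↦ levelHittingTimeReal B 1 ω ^ (1 / 4 : ℝ)) P := by
  have hF := integrable_prod_Ioi_of_integral_eq (P := P)
    (F := fun p ↦ (1 - Real.exp (-(p.2 ^ 2 / 2) * levelHittingTimeReal B 1 p.1)) *
      p.2 ^ (-(3 / 2) : ℝ))
    (m := fun θ ↦ (1 - Real.exp (-θ)) * θ ^ (-(3 / 2) : ℝ))
    ((hB.aemeasurable_exp_prod.const_sub 1).mul
      (measurable_snd.pow_const _).aemeasurable).aestronglyMeasurable
    (fun ω θ hθ ↦ by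
      have hθ' : 0 < θ := hθ
      have hT := levelHittingTimeReal_nonneg B 1 ω
      have : Real.exp (-(θ ^ 2 / 2) * levelHittingTimeReal B 1 ω) ≤ 1 :=
        Real.exp_le_one_iff.2 (by
          have : 0 ≤ θ ^ 2 / 2 * levelHittingTimeReal B 1 ω := by positivity
          linarith)
      exact mul_nonneg (by linarith) (by positivity))
    (fun θ hθ ↦ ((integrable_const _).sub
      (hB.integrable_exp_neg_levelHittingTimeReal hθ)).mul_const (θ ^ (-(3 / 2) : ℝ)))
    (fun θ hθ ↦ by
      simp only
      rw [integral_mul_const, integral_sub (integrable_const _)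
        (hB.integrable_exp_neg_levelHittingTimeReal hθ),
        hB.integral_exp_neg_levelHittingTimeReal hθ]
      simp)
    integrableOn_one_sub_exp_neg_mul_rpow
  have hconst : 0 < (1 - Real.exp (-(1 / 2))) * (2 : ℝ) ^ (-(3 / 2) : ℝ) := by
    have : Real.exp (-(1 / 2) : ℝ) < 1 := by
      rw [← Real.exp_zero]
      exact Real.exp_lt_exp.2 (by norm_num)
    exact mul_pos (by linarith) (by positivity)
  refine Integrable.mono' (hF.integral_prod_left.const_mul
    ((1 - Real.exp (-(1 / 2))) * (2 : ℝ) ^ (-(3 / 2) : ℝ))⁻¹)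
    (hB.aemeasurable_levelHittingTimeReal.pow_const _).aestronglyMeasurable ?_
  filter_upwards [hB.ae_levelHittingTimeReal_pos, hF.prod_right_ae] with ω hω hint
  rw [Real.norm_of_nonneg (by positivity), le_inv_mul_iff₀ hconst]
  exact rpow_quarter_mul_le_integral hω hint

end HittingTimeMoments

/-! ### Moments of the normalized path integral. -/

section AreaMoments

/-- Jensen's inequality for the average over `[0, t]`: the left side is `t^(-n)` times the `2n`-th
power of this average. -/
lemma normalized_integral_pow_le {f : ℝ → ℝ} (hf : Continuous f) {t : ℝ} (ht : 0 < t) (n : ℕ) :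
    (t ^ (-(3 / 2) : ℝ) * ∫ s in (0 : ℝ)..t, f s) ^ (2 * n) ≤
      (t ^ (n + 1))⁻¹ * ∫ s in (0 : ℝ)..t, f s ^ (2 * n) := by
  have hvol : (volume : Measure ℝ) (Set.Ioc 0 t) = ENNReal.ofReal t := by simp
  have hJ := ConvexOn.map_set_average_le (μ := volume) (t := Set.Ioc 0 t) (f := f)
    (Even.convexOn_pow (𝕜 := ℝ) (even_two_mul n)) (by fun_prop) isClosed_univ
    (by simp [hvol, ht]) (by simp [hvol]) (by simp)
    (hf.integrableOn_Ioc) ((hf.pow (2 * n)).integrableOn_Ioc)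
  rw [setAverage_eq, setAverage_eq, measureReal_def, hvol, ENNReal.toReal_ofReal ht.le,
    ← intervalIntegral.integral_of_le ht.le, ← intervalIntegral.integral_of_le ht.le,
    smul_eq_mul, smul_eq_mul] at hJ
  have hpow : (t ^ (-(3 / 2) : ℝ)) ^ (2 * n) = (t ^ n)⁻¹ * t⁻¹ ^ (2 * n) := by
    rw [← Real.rpow_natCast, ← Real.rpow_mul ht.le, inv_pow, ← mul_inv, ← pow_add,
      ← Real.rpow_natCast, ← Real.rpow_neg ht.le]
    congr 1
    push_cast
    ring
  rw [mul_pow, hpow, mul_assoc, ← mul_pow, pow_succ, mul_inv, mul_assoc]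
  gcongr

/-- Young's inequality separates the factor depending on `t` from the path. The path term can then
be integrated over the whole half-line, which removes the dependence between the hitting time and
the path. -/
lemma normalized_integral_pow_le_weighted {f : ℝ → ℝ} (hf : Continuous f) {t : ℝ} (ht : 0 < t)
    (n : ℕ) (hint : IntegrableOn
      (fun s : ℝ ↦ (1 + s) ^ (-(2 * n + 5 / 4) : ℝ) * f s ^ (2 * (2 * n))) (Set.Ioi 0)) :
    (t ^ (-(3 / 2) : ℝ) * ∫ s in (0 : ℝ)..t, f s) ^ (2 * n) ≤
      t ^ (-(2 * n + 1) : ℝ) * (1 + t) ^ (2 * n + 5 / 4 : ℝ) +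
      ∫ s in Set.Ioi (0 : ℝ), (1 + s) ^ (-(2 * n + 5 / 4) : ℝ) * f s ^ (2 * (2 * n)) := by
  set u := (t ^ (n + 1))⁻¹ with hu
  have hu0 : 0 < u := by positivity
  -- The exponent exceeds `2n + 1`, so that `(1 + s)^(-e) s^(2n)` is integrable at infinity, but
  -- only by `1/4`, so that the growth left in `t` is `t^(1/4)`.
  set e : ℝ := 2 * n + 5 / 4
  have he : 0 ≤ e := by positivity
  refine (normalized_integral_pow_le hf ht n).trans ?_
  have hsub : IntegrableOn (fun s : ℝ ↦ (1 + s) ^ (-e) * f s ^ (2 * (2 * n))) (Set.Ioc 0 t) :=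
    hint.mono_set Set.Ioc_subset_Ioi_self
  have hpt : ∀ s ∈ Set.Ioc 0 t,
      u * f s ^ (2 * n) ≤ u ^ 2 * (1 + t) ^ e + (1 + s) ^ (-e) * f s ^ (2 * (2 * n)) := by
    intro s hs
    have h1s : 0 < 1 + s := by linarith [hs.1]
    have hw : 0 < (1 + s) ^ e := by positivity
    have hmono : (1 + s) ^ e ≤ (1 + t) ^ e := by
      gcongr
      exact hs.2
    have hx : 0 ≤ f s ^ (2 * n) := (even_two_mul n).pow_nonneg _
    have hyoung : u * f s ^ (2 * n) ≤
        u ^ 2 * (1 + s) ^ e + ((1 + s) ^ e)⁻¹ * (f s ^ (2 * n)) ^ 2 := by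
      rw [← sub_nonneg]
      have hkey : u ^ 2 * (1 + s) ^ e + ((1 + s) ^ e)⁻¹ * (f s ^ (2 * n)) ^ 2 -
          u * f s ^ (2 * n) = ((1 + s) ^ e)⁻¹ *
          ((u * (1 + s) ^ e - f s ^ (2 * n)) ^ 2 + u * (1 + s) ^ e * f s ^ (2 * n)) := by
        field_simp
        ring
      rw [hkey]
      positivity
    have hsq : f s ^ (2 * (2 * n)) = (f s ^ (2 * n)) ^ 2 := by rw [← pow_mul, mul_comm]
    rw [Real.rpow_neg h1s.le, hsq]
    refine hyoung.trans ?_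
    gcongr
  rw [intervalIntegral.integral_of_le ht.le, ← integral_const_mul]
  have hconst : IntegrableOn (fun _ : ℝ ↦ u ^ 2 * (1 + t) ^ e) (Set.Ioc 0 t) :=
    continuous_const.integrableOn_Ioc
  calc _ ≤ ∫ s in Set.Ioc 0 t,
        (u ^ 2 * (1 + t) ^ e + (1 + s) ^ (-e) * f s ^ (2 * (2 * n))) :=
        setIntegral_mono_on ((hf.pow _).integrableOn_Ioc.const_mul u) (hconst.add hsub)
          measurableSet_Ioc hpt
    _ = t * (u ^ 2 * (1 + t) ^ e) +
        ∫ s in Set.Ioc 0 t, (1 + s) ^ (-e) * f s ^ (2 * (2 * n)) := by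
        rw [integral_add hconst hsub, setIntegral_const]
        simp [measureReal_def, ht.le]
    _ ≤ _ := by
        refine add_le_add (le_of_eq ?_) (setIntegral_mono_set hint
          ((ae_restrict_mem measurableSet_Ioi).mono fun s hs ↦ ?_)
          Set.Ioc_subset_Ioi_self.eventuallyLE)
        · rw [← mul_assoc, hu, inv_pow, Real.rpow_neg ht.le]
          congr 1
          have : t ^ (2 * n + 1 : ℝ) = t ^ (2 * n + 1) := by exact_mod_cast Real.rpow_natCast t _
          rw [this]
          field_simp
          ring
        · have : (0 : ℝ) < s := hs
          exact mul_nonneg (by positivity) ((even_two_mul _).pow_nonneg _)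

/-- Use `1 + t ≤ 2` when `t ≤ 1` and `1 + t ≤ 2t` otherwise. -/
lemma rpow_neg_mul_one_add_rpow_le {t : ℝ} (ht : 0 < t) {a : ℝ} (ha : 0 ≤ a) :
    t ^ (-a) * (1 + t) ^ (a + 1 / 4) ≤ 2 ^ (a + 1 / 4) * (t ^ (-a) + t ^ (1 / 4 : ℝ)) := by
  rw [mul_add]
  rcases le_total t 1 with h | h
  · have h1 : (1 + t) ^ (a + 1 / 4) ≤ 2 ^ (a + 1 / 4) := by
      gcongr
      linarith
    have h2 : 0 ≤ (2 : ℝ) ^ (a + 1 / 4) * t ^ (1 / 4 : ℝ) := by positivity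
    have h3 : 0 ≤ t ^ (-a) := by positivity
    nlinarith
  · have h1 : (1 + t) ^ (a + 1 / 4) ≤ (2 * t) ^ (a + 1 / 4) := by
      gcongr
      linarith
    have h2 : 0 ≤ (2 : ℝ) ^ (a + 1 / 4) * t ^ (-a) := by positivity
    have h3 : 0 ≤ t ^ (-a) := by positivity
    have h4 : t ^ (-a) * (2 * t) ^ (a + 1 / 4) = 2 ^ (a + 1 / 4) * t ^ (1 / 4 : ℝ) := by
      rw [Real.mul_rpow zero_le_two ht.le, mul_left_comm, ← Real.rpow_add ht]
      congr 2
      ring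
    have := mul_le_mul_of_nonneg_left h1 h3
    linarith

variable {Ω : Type*} [MeasurableSpace Ω] {P : Measure Ω} {B : ℝ≥0 → Ω → ℝ}

lemma IsRegularBrownian.integrable_prod_weight_mul_pow (hB : IsRegularBrownian B P)
    [IsFiniteMeasure P] (n : ℕ) :
    Integrable (fun p : Ω × ℝ ↦
      (1 + p.2) ^ (-(2 * n + 5 / 4) : ℝ) * B p.2.toNNReal p.1 ^ (2 * (2 * n)))
      (P.prod (volume.restrict (Set.Ioi 0))) := by
  set C := ∫ x, x ^ (2 * (2 * n)) ∂gaussianReal 0 1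
  have hC : 0 ≤ C := integral_nonneg fun x ↦ (even_two_mul _).pow_nonneg _
  refine hB.integrable_prod_weight_mul (φ := fun x ↦ x ^ (2 * (2 * n)))
    (w := fun s ↦ (1 + s) ^ (-(2 * n + 5 / 4) : ℝ)) (g := fun s ↦ s ^ (2 * n) * C)
    (by fun_prop) (fun x ↦ (even_two_mul _).pow_nonneg _)
    (fun t ↦ ((hB.hasFiniteMoments t).pow _).integrable) (by fun_prop)
    (fun s hs ↦ by positivity) (fun s ↦ (hB.integral_pow_two_mul (2 * n) s).le) ?_
  have hdom : IntegrableOn (fun s : ℝ ↦ (s + 1) ^ (-(5 / 4) : ℝ) * C) (Set.Ioi 0) :=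
    (integrableOn_add_rpow_Ioi_of_lt (by norm_num) (by norm_num)).mul_const C
  refine Integrable.mono' hdom (by fun_prop)
    ((ae_restrict_mem measurableSet_Ioi).mono fun s hs ↦ ?_)
  have hs0 : 0 < s := hs
  rw [Real.norm_of_nonneg (by positivity), ← mul_assoc]
  gcongr
  have hsplit : (s + 1) ^ (-(5 / 4) : ℝ) = (1 + s) ^ (-(2 * n + 5 / 4) : ℝ) * (1 + s) ^ (2 * n) := by
    rw [← Real.rpow_natCast, ← Real.rpow_add (by positivity), add_comm s]
    congr 1
    push_cast
    ring
  rw [hsplit]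
  gcongr
  linarith

variable [IsProbabilityMeasure P]

lemma IsRegularBrownian.aestronglyMeasurable_normalizedPathIntegral
    (hB : IsRegularBrownian B P) : AEStronglyMeasurable (normalizedPathIntegral B) P :=
  (hB.aemeasurable_levelHittingTimeReal.pow_const _).aestronglyMeasurable.mul
    hB.aestronglyMeasurable_integral_levelHittingTimeReal

lemma IsRegularBrownian.integrable_normalizedPathIntegral_pow (hB : IsRegularBrownian B P)
    (n : ℕ) : Integrable (fun ω ↦ normalizedPathIntegral B ω ^ (2 * n)) P := by
  have hW := hB.integrable_prod_weight_mul_pow n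
  -- This `q` gives the exponent `-(q + 1) / 2 = -(2n + 1)`.
  have hneg := hB.integrable_levelHittingTimeReal_rpow_neg (q := 4 * n + 1)
    (by have : (0 : ℝ) ≤ n := n.cast_nonneg
        linarith)
  refine Integrable.mono' (((hneg.add hB.integrable_levelHittingTimeReal_rpow_quarter).const_mul
    (2 ^ (2 * n + 1 + 1 / 4 : ℝ))).add hW.integral_prod_left)
    (hB.aestronglyMeasurable_normalizedPathIntegral.pow _) ?_
  filter_upwards [hB.ae_levelHittingTimeReal_pos, hW.prod_right_ae] with ω hω hint
  rw [Real.norm_of_nonneg ((even_two_mul n).pow_nonneg _)]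
  refine (normalized_integral_pow_le_weighted (hB.continuous_toNNReal ω) hω n hint).trans ?_
  refine add_le_add ?_ le_rfl
  have h := rpow_neg_mul_one_add_rpow_le hω (a := 2 * n + 1) (by positivity)
  have h1 : (2 * n + 1 + 1 / 4 : ℝ) = 2 * n + 5 / 4 := by ring
  have h2 : -((4 * n + 1 : ℝ) + 1) / 2 = -(2 * n + 1) := by ring
  simp only [Pi.add_apply]
  rw [h1] at h ⊢
  rw [h2]
  exact h

lemma IsRegularBrownian.memLp_normalizedPathIntegral (hB : IsRegularBrownian B P) (p : ℝ≥0) :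
    MemLp (normalizedPathIntegral B) p P := by
  obtain ⟨n, hn⟩ := exists_nat_ge p
  have hmem : MemLp (normalizedPathIntegral B) ((2 * (n + 1) : ℕ) : ℝ≥0∞) P := by
    rw [← integrable_norm_rpow_iff hB.aestronglyMeasurable_normalizedPathIntegral
      (Nat.cast_ne_zero.2 (by omega)) (ENNReal.natCast_ne_top _)]
    refine (hB.integrable_normalizedPathIntegral_pow (n + 1)).congr (ae_of_all _ fun ω ↦ ?_)
    simp only
    rw [ENNReal.toReal_natCast, Real.rpow_natCast, Real.norm_eq_abs, (even_two_mul _).pow_abs]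
  refine hmem.mono_exponent ?_
  have : p ≤ ((2 * (n + 1) : ℕ) : ℝ≥0) := hn.trans (Nat.cast_le.2 (by omega))
  exact_mod_cast this

/-! ### The mean of the normalized path integral. -/

lemma integral_exp_neg_mul_sub_one :
    ∫ θ in Set.Ioi (0 : ℝ), Real.exp (-θ) * (θ - 1) = 0 := by
  have h1 := Real.GammaIntegral_convergent (s := 1) one_pos
  have h2 := Real.GammaIntegral_convergent (s := 2) two_pos
  have g1 := Real.Gamma_eq_integral (s := 1) one_pos
  have g2 := Real.Gamma_eq_integral (s := 2) two_pos
  rw [Real.Gamma_one] at g1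
  rw [Real.Gamma_two] at g2
  have : ∫ θ in Set.Ioi (0 : ℝ), Real.exp (-θ) * (θ - 1) = ∫ θ in Set.Ioi (0 : ℝ),
      (Real.exp (-θ) * θ ^ ((2 : ℝ) - 1) - Real.exp (-θ) * θ ^ ((1 : ℝ) - 1)) := by
    congr 1 with θ
    norm_num
    ring
  rw [this, integral_sub h2 h1, ← g1, ← g2, sub_self]

lemma IsRegularBrownian.integral_normalizedPathIntegral (hB : IsRegularBrownian B P) :
    ∫ ω, normalizedPathIntegral B ω ∂P = 0 := by
  -- `κ` is the integral of `θ² exp (-θ² / 2)` over the half-line.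
  set κ : ℝ := (1 / 2) ^ (-((2 : ℝ) + 1) / 2) * (1 / 2) * Real.Gamma (((2 : ℝ) + 1) / 2)
  have hκ : 0 < κ := by
    have := Real.Gamma_pos_of_pos (s := ((2 : ℝ) + 1) / 2) (by norm_num)
    positivity
  set I : Ω → ℝ := fun ω ↦ ∫ s in (0 : ℝ)..levelHittingTimeReal B 1 ω, B s.toNNReal ω
  have hinner (ω : Ω) (hω : 0 < levelHittingTimeReal B 1 ω) :
      ∫ θ in Set.Ioi (0 : ℝ), θ ^ (2 : ℝ) * Real.exp (-(θ ^ 2 / 2) * levelHittingTimeReal B 1 ω) =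
        levelHittingTimeReal B 1 ω ^ (-(3 / 2) : ℝ) * κ := by
    rw [integral_rpow_mul_exp_neg_half_sq_mul (by norm_num) hω]
    norm_num [κ]
  have hA : Integrable (normalizedPathIntegral B) P :=
    memLp_one_iff_integrable.1 (hB.memLp_normalizedPathIntegral 1)
  have hmeas : AEStronglyMeasurable (Function.uncurry fun (ω : Ω) (θ : ℝ) ↦
      θ ^ (2 : ℝ) * Real.exp (-(θ ^ 2 / 2) * levelHittingTimeReal B 1 ω) * I ω)
      (P.prod (volume.restrict (Set.Ioi 0))) :=
    ((measurable_snd.pow_const _).aemeasurable.mul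
      hB.aemeasurable_exp_prod).aestronglyMeasurable.mul
      hB.aestronglyMeasurable_integral_levelHittingTimeReal.comp_fst
  have hprod : Integrable (Function.uncurry fun (ω : Ω) (θ : ℝ) ↦
      θ ^ (2 : ℝ) * Real.exp (-(θ ^ 2 / 2) * levelHittingTimeReal B 1 ω) * I ω)
      (P.prod (volume.restrict (Set.Ioi 0))) := by
    rw [integrable_prod_iff hmeas]
    constructor
    · filter_upwards [hB.ae_levelHittingTimeReal_pos] with ω hω
      exact (integrableOn_rpow_mul_exp_neg_half_sq_mul (q := 2) (by norm_num) hω).mul_const (I ω)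
    -- Integrating the absolute value over `θ` first gives exactly `κ |A|`, so Fubini rests on the
    -- first moment of `A` alone.
    · refine (hA.norm.mul_const κ).congr ?_
      filter_upwards [hB.ae_levelHittingTimeReal_pos] with ω hω
      have hnorm : ∀ θ ∈ Set.Ioi (0 : ℝ),
          ‖θ ^ (2 : ℝ) * Real.exp (-(θ ^ 2 / 2) * levelHittingTimeReal B 1 ω) * I ω‖ =
          θ ^ (2 : ℝ) * Real.exp (-(θ ^ 2 / 2) * levelHittingTimeReal B 1 ω) * ‖I ω‖ := by
        intro θ hθ
        have : (0 : ℝ) < θ := hθ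
        rw [norm_mul, Real.norm_of_nonneg (by positivity)]
      simp only [Function.uncurry_apply_pair]
      rw [setIntegral_congr_fun measurableSet_Ioi hnorm, integral_mul_const, hinner ω hω,
        normalizedPathIntegral, norm_mul, Real.norm_of_nonneg (by positivity)]
      ring
  have hswap := integral_integral_swap hprod
  have hleft : ∫ ω, (∫ θ in Set.Ioi (0 : ℝ),
      θ ^ (2 : ℝ) * Real.exp (-(θ ^ 2 / 2) * levelHittingTimeReal B 1 ω) * I ω) ∂P =
      κ * ∫ ω, normalizedPathIntegral B ω ∂P := by
    rw [← integral_const_mul]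
    refine integral_congr_ae ?_
    filter_upwards [hB.ae_levelHittingTimeReal_pos] with ω hω
    rw [integral_mul_const, hinner ω hω, normalizedPathIntegral]
    ring
  have hright : ∫ θ in Set.Ioi (0 : ℝ), ∫ ω,
      θ ^ (2 : ℝ) * Real.exp (-(θ ^ 2 / 2) * levelHittingTimeReal B 1 ω) * I ω ∂P = 0 := by
    have : ∀ θ ∈ Set.Ioi (0 : ℝ), ∫ ω,
        θ ^ (2 : ℝ) * Real.exp (-(θ ^ 2 / 2) * levelHittingTimeReal B 1 ω) * I ω ∂P =
        1 / 2 * (Real.exp (-θ) * (θ - 1)) := by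
      intro θ hθ
      have hθ0 : (0 : ℝ) < θ := hθ
      simp_rw [mul_assoc]
      rw [integral_const_mul, hB.integral_exp_mul_pathIntegral hθ0, Real.rpow_two]
      field_simp
    rw [setIntegral_congr_fun measurableSet_Ioi this, integral_const_mul,
      integral_exp_neg_mul_sub_one, mul_zero]
  rw [hleft, hright] at hswap
  exact (mul_eq_zero.1 hswap).resolve_left hκ.ne'

end AreaMoments

/-! ### Reduction to everywhere continuous paths. -/

section Regularization

lemma levelHittingTime_congr {Ω : Type*} {X Y : ℝ≥0 → Ω → ℝ} {ω : Ω} (h : ∀ t, X t ω = Y t ω)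
    (a : ℝ) : levelHittingTime X a ω = levelHittingTime Y a ω := by
  have hX : (∃ j, 0 ≤ j ∧ X j ω ∈ ({a} : Set ℝ)) ↔ ∃ j, 0 ≤ j ∧ Y j ω ∈ ({a} : Set ℝ) := by
    simp only [h]
  by_cases hY : ∃ j, 0 ≤ j ∧ Y j ω ∈ ({a} : Set ℝ)
  · rw [levelHittingTime, levelHittingTime, hittingAfter, hittingAfter, if_pos hY,
      if_pos (hX.2 hY)]
    simp only [h]
  · rw [levelHittingTime, levelHittingTime, hittingAfter, hittingAfter, if_neg hY,
      if_neg (mt hX.1 hY)]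

lemma normalizedPathIntegral_congr {Ω : Type*} {X Y : ℝ≥0 → Ω → ℝ} {ω : Ω}
    (h : ∀ t, X t ω = Y t ω) : normalizedPathIntegral X ω = normalizedPathIntegral Y ω := by
  simp only [normalizedPathIntegral, levelHittingTimeReal, levelHittingTime_congr h, h]

/-- Replace the process by `0` off a measurable set `G` of full measure on which the path is
continuous, starts at `0` and agrees with measurable versions at a countable dense set of times.
Measurability at the other times follows by pointwise limits. -/
lemma ProbabilityTheory.IsBrownianReal.exists_isRegularBrownian {Ω : Type*} [MeasurableSpace Ω]
    {P : Measure Ω} {B : ℝ≥0 → Ω → ℝ} (hB : IsBrownianReal B P) :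
    ∃ X : ℝ≥0 → Ω → ℝ, IsRegularBrownian X P ∧ ∀ᵐ ω ∂P, ∀ t, B t ω = X t ω := by
  have hgood : ∀ᵐ ω ∂P, Continuous (B · ω) ∧ B 0 ω = 0 ∧
      ∀ n : ℕ, B (TopologicalSpace.denseSeq ℝ≥0 n) ω =
        (hB.aemeasurable (TopologicalSpace.denseSeq ℝ≥0 n)).mk _ ω :=
    hB.cont.and (hB.eval_zero_ae_eq_zero.and (ae_all_iff.2 fun n ↦ (hB.aemeasurable _).ae_eq_mk))
  obtain ⟨G, hGae, hGm, hG⟩ := hgood.exists_measurable_mem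
  have hcont ω : Continuous fun t ↦ G.indicator (B t) ω := by
    by_cases hω : ω ∈ G
    · simpa only [Set.indicator_of_mem hω] using (hG ω hω).1
    · simpa only [Set.indicator_of_notMem hω] using continuous_const
  have hae : ∀ᵐ ω ∂P, ∀ t, B t ω = G.indicator (B t) ω := by
    filter_upwards [hGae] with ω hω t
    rw [Set.indicator_of_mem hω]
  have hdense n : Measurable (G.indicator (B (TopologicalSpace.denseSeq ℝ≥0 n))) := by
    have : G.indicator (B (TopologicalSpace.denseSeq ℝ≥0 n)) =
        G.indicator ((hB.aemeasurable (TopologicalSpace.denseSeq ℝ≥0 n)).mk _) :=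
      Set.indicator_congr fun ω hω ↦ (hG ω hω).2.2 n
    rw [this]
    exact (hB.aemeasurable _).measurable_mk.indicator hGm
  refine ⟨fun t ↦ G.indicator (B t), ⟨hB.toIsPreBrownianReal.congr fun t ↦ hae.mono fun ω h ↦ h t,
    fun t ↦ ?_, hcont, fun ω ↦ ?_⟩, hae⟩
  · obtain ⟨x, hx, hlim⟩ := mem_closure_iff_seq_limit.1
      (TopologicalSpace.denseRange_denseSeq ℝ≥0 t)
    refine measurable_of_tendsto_metrizable (f := fun k ↦ G.indicator (B (x k))) (fun k ↦ ?_)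
      (tendsto_pi_nhds.2 fun ω ↦ ((hcont ω).tendsto t).comp hlim)
    obtain ⟨n, hn⟩ := hx k
    rw [← hn]
    exact hdense n
  · by_cases hω : ω ∈ G
    · rw [Set.indicator_of_mem hω, (hG ω hω).2.1]
    · rw [Set.indicator_of_notMem hω]

end Regularization

theorem theorem1 {Ω : Type*} [MeasurableSpace Ω] (P : Measure Ω) [IsProbabilityMeasure P]
    (B : ℝ≥0 → Ω → ℝ) (hB : IsBrownianReal B P) :
    (∀ᵐ ω ∂P, 0 < levelHittingTime B 1 ω ∧ levelHittingTime B 1 ω < ⊤) ∧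
    (∀ p : ℝ≥0, MemLp (normalizedPathIntegral B) p P) ∧
    ∫ ω, normalizedPathIntegral B ω ∂P = 0 := by
  obtain ⟨X, hX, hBX⟩ := hB.exists_isRegularBrownian
  have hA : normalizedPathIntegral X =ᵐ[P] normalizedPathIntegral B :=
    hBX.mono fun ω h ↦ (normalizedPathIntegral_congr h).symm
  refine ⟨?_, fun p ↦ (hX.memLp_normalizedPathIntegral p).ae_eq hA,
    (integral_congr_ae hA).symm.trans hX.integral_normalizedPathIntegral⟩
  filter_upwards [hBX, hX.ae_levelHittingTime_lt_top] with ω h hω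
  rw [levelHittingTime_congr h]
  exact ⟨hX.levelHittingTime_pos ω, hω⟩
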